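/- Let $\mu$ be a nontrivial positive measure on the unit circle $\mathbb{T}$, i.e. a finite positive Borel measure whose support is an infinite set. Let $\Phi_n$, $n\ge 0$, be its monic orthogonal polynomials ($\Phi_n$ is monic of degree $n$ and $\int_{\mathbb{T}}\Phi_n\overline{\Phi_m}\,d\mu=0$ for $n\neq m$), and let $\alpha_n=-\overline{\Phi_{n+1}(0)}$, $n\ge 0$, be its Verblunsky coefficients. For $\vartheta>0$ define $$\tau_0^{(\vartheta)}=e^{i\vartheta},\qquad \tau_n^{(\vartheta)}=e^{i\vartheta}\,\tau_{n-1}^{(\vartheta)}\,\frac{1-\overline{\tau_{n-1}^{(\vartheta)}\alpha_{n-1}}}{1-\tau_{n-1}^{(\vartheta)}\alpha_{n-1}},\quad n\ge 1,$$ $$c_n^{(\vartheta)}=\frac{-\operatorname{Im}(\tau_{n-1}^{(\vartheta)}\alpha_{n-1})}{1-\operatorname{Re}(\tau_{n-1}^{(\vartheta)}\alpha_{n-1})},\qquad g_n^{(\vartheta)}=\frac12\,\frac{|1-\tau_{n-1}^{(\vartheta)}\alpha_{n-1}|^2}{1-\operatorname{Re}(\tau_{n-1}^{(\vartheta)}\alpha_{n-1})},\qquad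 d_{n+1}^{(\vartheta)}=(1-g_n^{(\vartheta)})\,g_{n+1}^{(\vartheta)},\quad n\ge 1,$$ and, for $x\in[-1,1]$, $$\mathfrak d_{n+1}^{(\vartheta)}(x)=\frac{d_{n+1}^{(\vartheta)}}{\big(x-c_n^{(\vartheta)}\sqrt{1-x^2}\big)\big(x-c_{n+1}^{(\vartheta)}\sqrt{1-x^2}\big)},\quad n\ge 1.$$ Let $\vartheta_1,\vartheta_2\in\mathbb{R}$ satisfy $0<\vartheta_2-\vartheta_1\le 2\pi$ and $\vartheta_2>0$, put $x(\vartheta_1,\vartheta_2)=\cos\big((2\pi+\vartheta_1-\vartheta_2)/2\big)$ and $$\mathfrak m_0^{(\vartheta_1,\vartheta_2)}=0,\qquad \mathfrak m_n^{(\vartheta_1,\vartheta_2)}=\frac{\mathfrak d_{n+1}^{(\vartheta_2)}\big(x(\vartheta_1,\vartheta_2)\big)}{1-\mathfrak m_{n-1}^{(\vartheta_1,\vartheta_2)}},\quad n\ge 1.$$ Let $\mathcal A(\vartheta_1,\vartheta_2)=\{e^{i\theta}:\vartheta_1<\theta<\vartheta_2\}$. Then $$\operatorname{supp}\mu\cap\mathcal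 A(\vartheta_1,\vartheta_2)=\emptyset$$ if and only if $$\cot\big((2\pi+\vartheta_1-\vartheta_2)/2\big)<c_1^{(\vartheta_2)}\quad\text{and}\quad 0<\mathfrak m_n^{(\vartheta_1,\vartheta_2)}<1\ \text{ for all } n\ge 1.$$ Here $\cot 0=+\infty$ (this occurs only if $\vartheta_2-\vartheta_1=2\pi$), and if a denominator in the definition of the $\mathfrak m_n^{(\vartheta_1,\vartheta_2)}$ vanishes, the condition $0<\mathfrak m_n^{(\vartheta_1,\vartheta_2)}<1$ for all $n\geq 1$ is understood to fail. -/

import Mathlib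

open MeasureTheory Polynomial
open scoped ComplexConjugate

namespace RotatedOPUC

noncomputable section

/-- The unit circle carries its Borel σ-algebra. -/
instance instMeasurableSpaceCircle : MeasurableSpace Circle := borel Circle

instance instBorelSpaceCircle : BorelSpace Circle := ⟨rfl⟩

/-- The Hermitian form `⟨p, q⟩ = ∫_𝕋 p(z) conj(q(z)) dμ(z)` on complex polynomials. -/
def ip (μ : Measure Circle) (p q : ℂ[X]) : ℂ :=
  ∫ z : Circle, p.eval (z : ℂ) * conj (q.eval (z : ℂ)) ∂μ

/-- The monic orthogonal polynomials `Φ_n` of `μ`, obtained from `1, z, z², …` by the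
Gram-Schmidt process (without normalisation). -/
def monicOPUC (μ : Measure Circle) (n : ℕ) : ℂ[X] :=
  X ^ n - ∑ j : Fin n,
    C (ip μ (X ^ n) (monicOPUC μ j) / ip μ (monicOPUC μ j) (monicOPUC μ j)) * monicOPUC μ j
termination_by n
decreasing_by all_goals exact j.isLt

/-- The Verblunsky coefficients `α_n = -conj (Φ_{n+1}(0))`, `n ≥ 0`. -/
def verblunsky (μ : Measure Circle) (n : ℕ) : ℂ :=
  -conj ((monicOPUC μ (n + 1)).eval 0)

/-- `τ_0 = e^{iϑ}`, `τ_n = e^{iϑ} τ_{n-1} (1 - conj (τ_{n-1} α_{n-1})) / (1 - τ_{n-1} α_{n-1})`. -/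
def tau (α : ℕ → ℂ) (ϑ : ℝ) : ℕ → ℂ
  | 0 => Complex.exp (Complex.I * ϑ)
  | n + 1 => Complex.exp (Complex.I * ϑ) * tau α ϑ n *
      ((1 - conj (tau α ϑ n * α n)) / (1 - tau α ϑ n * α n))

/-- `c_n^{(ϑ)}` for `n ≥ 1`. -/
def cCoeff (α : ℕ → ℂ) (ϑ : ℝ) (n : ℕ) : ℝ :=
  -(tau α ϑ (n - 1) * α (n - 1)).im / (1 - (tau α ϑ (n - 1) * α (n - 1)).re)

/-- `g_n^{(ϑ)}` for `n ≥ 1`. -/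
def gCoeff (α : ℕ → ℂ) (ϑ : ℝ) (n : ℕ) : ℝ :=
  1 / 2 * (‖1 - tau α ϑ (n - 1) * α (n - 1)‖ ^ 2 / (1 - (tau α ϑ (n - 1) * α (n - 1)).re))

/-- `dSucc α ϑ n` is `d_{n+1}^{(ϑ)} = (1 - g_n^{(ϑ)}) g_{n+1}^{(ϑ)}`, for `n ≥ 1`. -/
def dSucc (α : ℕ → ℂ) (ϑ : ℝ) (n : ℕ) : ℝ :=
  (1 - gCoeff α ϑ n) * gCoeff α ϑ (n + 1)

/-- `dFrakSucc α ϑ n x` is `𝔡_{n+1}^{(ϑ)}(x)`, for `n ≥ 1` and `x ∈ [-1, 1]`. -/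
def dFrakSucc (α : ℕ → ℂ) (ϑ : ℝ) (n : ℕ) (x : ℝ) : ℝ :=
  dSucc α ϑ n /
    ((x - cCoeff α ϑ n * √(1 - x ^ 2)) * (x - cCoeff α ϑ (n + 1) * √(1 - x ^ 2)))

/-- `x(ϑ₁, ϑ₂) = cos ((2π + ϑ₁ - ϑ₂) / 2)`. -/
def xPoint (ϑ₁ ϑ₂ : ℝ) : ℝ :=
  Real.cos ((2 * Real.pi + ϑ₁ - ϑ₂) / 2)

/-- `𝔪_0 = 0`, `𝔪_n = 𝔡_{n+1}^{(ϑ₂)}(x(ϑ₁, ϑ₂)) / (1 - 𝔪_{n-1})` for `n ≥ 1`. -/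
def mSeq (α : ℕ → ℂ) (ϑ₁ ϑ₂ : ℝ) : ℕ → ℝ
  | 0 => 0
  | n + 1 => dFrakSucc α ϑ₂ (n + 1) (xPoint ϑ₁ ϑ₂) / (1 - mSeq α ϑ₁ ϑ₂ n)

/-- The cotangent on `[0, π)`, with the value `cot 0 = +∞` (the limit from the right). -/
def cotTop (φ : ℝ) : EReal :=
  if φ = 0 then ⊤ else (Real.cot φ : EReal)

/-- The open arc `{e^{iθ} : ϑ₁ < θ < ϑ₂}`. -/
def openArc (ϑ₁ ϑ₂ : ℝ) : Set Circle :=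
  Circle.exp '' Set.Ioo ϑ₁ ϑ₂

end

end RotatedOPUC

open MeasureTheory Polynomial
open scoped ComplexConjugate

namespace RotatedOPUC

/-! ### The Hermitian form -/

/-! Let `z₁ = e^{iϑ₁}`, `w = e^{iϑ₂}`, `φ = (2π + ϑ₁ - ϑ₂)/2`, `e = e^{iφ}`, and suppose the arc is
shorter than the full circle. On the circle, `s(z) = -conj e (z - z₁) conj (z - w)` is real and
negative exactly on the arc (`arcFactor_exp`). So there is a gap iff `s ≥ 0` on the support, that
is, iff the form `∫ |p|² s dμ` is positive on polynomials: Stone–Weierstrass gives one direction,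
finiteness of the zeros of `s` and `p` the other.

Christoffel's formula yields polynomials orthogonal for this form, built from the kernels `K_n(z₁,
w)` (`exists_twisted_orthogonal`). Writing `K_n(z₁, w) = e^n V_n`, the form takes the value `-V_n
V_{n+1} ‖Φ_{n+1}‖²` at the `n`-th of them, and `V_n` is real. Hence a gap means precisely that `V_n`
alternates in sign (`gap_iff_alternating`).

Christoffel–Darboux and the Szegő recurrence give `(1 - g_{n+1}) V_{n+1} = (cos φ - c_{n+1} sin φ)
V_n - g_{n+1} V_{n-1}`. The ratios of consecutive `V_n` then encode `1 - 𝔪_n`, so alternation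
becomes `cos φ < c_1 sin φ` together with `0 < 𝔪_n < 1` (`alternating_iff_chain`). -/

lemma circle_mul_conj (z : Circle) : (z : ℂ) * conj (z : ℂ) = 1 := by
  rw [Complex.mul_conj, Circle.normSq_coe, Complex.ofReal_one]

lemma circle_conj_mul (z : Circle) : conj (z : ℂ) * (z : ℂ) = 1 := by
  rw [mul_comm, circle_mul_conj]

lemma continuous_eval_circle (p : ℂ[X]) : Continuous fun z : Circle => p.eval (z : ℂ) :=
  p.continuous.comp continuous_induced_dom

lemma integrable_of_continuous_circle {E : Type*} [NormedAddCommGroup E] [NormedSpace ℝ E]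
    [SecondCountableTopology E]
    (μ : Measure Circle) [IsFiniteMeasure μ] {f : Circle → E} (hf : Continuous f) :
    Integrable f μ := by
  obtain ⟨B, hB⟩ := (isCompact_univ (X := Circle)).exists_bound_of_continuousOn hf.continuousOn
  exact Integrable.of_bound hf.aestronglyMeasurable B (.of_forall fun z => hB z (Set.mem_univ z))

lemma integrable_ip (μ : Measure Circle) [IsFiniteMeasure μ] (p q : ℂ[X]) :
    Integrable (fun z : Circle => p.eval (z : ℂ) * conj (q.eval (z : ℂ))) μ :=
  integrable_of_continuous_circle μ <|
    (continuous_eval_circle p).mul (Complex.continuous_conj.comp (continuous_eval_circle q))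

/-- `p ↦ ⟨p, q⟩` as a linear map. -/
noncomputable def ipLeft (μ : Measure Circle) [IsFiniteMeasure μ] (q : ℂ[X]) : ℂ[X] →ₗ[ℂ] ℂ where
  toFun p := ip μ p q
  map_add' p₁ p₂ := by
    simp only [ip, eval_add, add_mul]
    exact integral_add (integrable_ip μ p₁ q) (integrable_ip μ p₂ q)
  map_smul' c p := by
    simp only [ip, eval_smul, smul_eq_mul, mul_assoc, RingHom.id_apply]
    exact integral_const_mul c _

lemma conj_ip (μ : Measure Circle) (p q : ℂ[X]) : conj (ip μ p q) = ip μ q p := by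
  rw [ip, ip, ← integral_conj]
  congr 1 with z
  simp [mul_comm]

lemma ip_X_mul_X_mul (μ : Measure Circle) (p q : ℂ[X]) : ip μ (X * p) (X * q) = ip μ p q := by
  rw [ip, ip]
  congr 1 with z
  simp only [eval_mul, eval_X, map_mul]
  linear_combination (p.eval (z : ℂ) * conj (q.eval (z : ℂ))) * circle_mul_conj z

lemma ip_eq_zero_comm (μ : Measure Circle) {p q : ℂ[X]} (h : ip μ p q = 0) : ip μ q p = 0 := by
  rw [← conj_ip, h, map_zero]

lemma ip_self_eq_integral (μ : Measure Circle) (p : ℂ[X]) :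
    ip μ p p = ((∫ z : Circle, ‖p.eval (z : ℂ)‖ ^ 2 ∂μ : ℝ) : ℂ) := by
  rw [ip, ← integral_complex_ofReal]
  congr 1 with z
  rw [Complex.mul_conj, Complex.normSq_eq_norm_sq]

lemma eq_zero_of_support_subset_zeros {μ : Measure Circle} (hμ : μ.support.Infinite) {p : ℂ[X]}
    (h : ∀ z ∈ μ.support, p.eval (z : ℂ) = 0) : p = 0 := by
  refine Polynomial.eq_zero_of_infinite_isRoot p ?_
  refine (hμ.image (f := fun z : Circle => (z : ℂ)) Circle.coe_injective.injOn).mono ?_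
  rintro _ ⟨z, hz, rfl⟩
  exact h z hz

section Form

variable (μ : Measure Circle) [IsFiniteMeasure μ]

@[simp] lemma ipLeft_apply (p q : ℂ[X]) : ipLeft μ q p = ip μ p q := rfl

lemma ip_add_left (p₁ p₂ q : ℂ[X]) : ip μ (p₁ + p₂) q = ip μ p₁ q + ip μ p₂ q :=
  (ipLeft μ q).map_add p₁ p₂

lemma ip_sub_left (p₁ p₂ q : ℂ[X]) : ip μ (p₁ - p₂) q = ip μ p₁ q - ip μ p₂ q :=
  (ipLeft μ q).map_sub p₁ p₂

lemma ip_C_mul_left (c : ℂ) (p q : ℂ[X]) : ip μ (C c * p) q = c * ip μ p q := by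
  rw [← smul_eq_C_mul]
  exact (ipLeft μ q).map_smul c p

lemma ip_add_right (p q₁ q₂ : ℂ[X]) : ip μ p (q₁ + q₂) = ip μ p q₁ + ip μ p q₂ := by
  rw [← conj_ip, ip_add_left, map_add, conj_ip, conj_ip]

lemma ip_C_mul_right (c : ℂ) (p q : ℂ[X]) : ip μ p (C c * q) = conj c * ip μ p q := by
  rw [← conj_ip, ip_C_mul_left, map_mul, conj_ip]

variable {μ}

/-- A nonnegative continuous function with vanishing integral vanishes on the support. -/
lemma eq_zero_of_mem_support_of_integral_eq_zero {f : Circle → ℝ} (hf : Continuous f)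
    (h0 : ∀ z ∈ μ.support, 0 ≤ f z) (hint : ∫ z, f z ∂μ = 0) {z : Circle}
    (hz : z ∈ μ.support) : f z = 0 := by
  have hae : ∀ᵐ z ∂μ, z ∈ μ.support := Measure.support_mem_ae
  have h := (integral_eq_zero_iff_of_nonneg_ae (hae.mono h0)
    (integrable_of_continuous_circle μ hf)).1 hint
  have hsub : μ.support ⊆ {z | f z = 0} :=
    Measure.support_subset_of_isClosed (isClosed_eq hf continuous_const) h
  exact hsub hz

/-- A polynomial of norm zero vanishes on the support, which is infinite. This definiteness makes
the Gram–Schmidt denominators nonzero. -/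
lemma eq_zero_of_ip_self_eq_zero (hμ : μ.support.Infinite) {p : ℂ[X]} (h : ip μ p p = 0) :
    p = 0 := by
  rw [ip_self_eq_integral] at h
  refine eq_zero_of_support_subset_zeros hμ fun z hz => ?_
  have := eq_zero_of_mem_support_of_integral_eq_zero
    (f := fun z : Circle => ‖p.eval (z : ℂ)‖ ^ 2)
    ((continuous_eval_circle p).norm.pow 2) (fun _ _ => by positivity)
    (by exact_mod_cast h) hz
  simpa using this

end Form

/-! ### Monic polynomials -/

lemma monicOPUC_eq (μ : Measure Circle) (n : ℕ) :
    monicOPUC μ n = X ^ n - ∑ j : Fin n,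
      C (ip μ (X ^ n) (monicOPUC μ j) / ip μ (monicOPUC μ j) (monicOPUC μ j)) *
        monicOPUC μ j := by
  rw [monicOPUC]

@[simp] lemma monicOPUC_zero (μ : Measure Circle) : monicOPUC μ 0 = 1 := by
  rw [monicOPUC_eq]; simp

lemma degree_monicOPUC_and_monic (μ : Measure Circle) (n : ℕ) :
    (monicOPUC μ n).degree = n ∧ (monicOPUC μ n).Monic := by
  induction n using Nat.strong_induction_on with
  | _ n ih =>
    have hlt : (∑ j : Fin n,
        C (ip μ (X ^ n) (monicOPUC μ j) / ip μ (monicOPUC μ j) (monicOPUC μ j)) *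
          monicOPUC μ j).degree < (n : WithBot ℕ) := by
      refine (Finset.sup_lt_iff (WithBot.bot_lt_coe n)).2 (fun j _ => ?_) |>.trans_le'
        (degree_sum_le _ _)
      calc _ ≤ degree (C _) + degree (monicOPUC μ j) := degree_mul_le _ _
        _ ≤ 0 + degree (monicOPUC μ j) := by gcongr; exact degree_C_le
        _ = (j : ℕ) := by rw [zero_add, (ih j j.2).1]
        _ < n := by exact_mod_cast j.2
    rw [monicOPUC_eq]
    refine ⟨?_, monic_X_pow_sub hlt⟩
    rw [degree_sub_eq_left_of_degree_lt (by simpa using hlt), degree_X_pow]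

lemma degree_monicOPUC (μ : Measure Circle) (n : ℕ) : (monicOPUC μ n).degree = n :=
  (degree_monicOPUC_and_monic μ n).1

lemma monic_monicOPUC (μ : Measure Circle) (n : ℕ) : (monicOPUC μ n).Monic :=
  (degree_monicOPUC_and_monic μ n).2

lemma natDegree_monicOPUC (μ : Measure Circle) (n : ℕ) : (monicOPUC μ n).natDegree = n :=
  natDegree_eq_of_degree_eq_some (degree_monicOPUC μ n)

lemma coeff_monicOPUC_self (μ : Measure Circle) (n : ℕ) : (monicOPUC μ n).coeff n = 1 := by
  have := monic_monicOPUC μ n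
  rwa [Monic, leadingCoeff, natDegree_monicOPUC] at this

lemma degree_sub_C_mul_lt {p q : ℂ[X]} {n : ℕ} (hp : p.degree < (n + 1 : ℕ))
    (hq : q.degree < (n + 1 : ℕ)) {c : ℂ} (h : p.coeff n = c * q.coeff n) :
    (p - C c * q).degree < n := by
  rw [degree_lt_iff_coeff_zero] at *
  intro m hm
  rcases hm.eq_or_lt with rfl | hm
  · simp [h]
  · simp [hp m hm, hq m hm]

lemma degree_lt_succ {p : ℂ[X]} {n : ℕ} (hp : p.degree < n) : p.degree < (n + 1 : ℕ) :=
  hp.trans (by exact_mod_cast n.lt_succ_self)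

lemma degree_monicOPUC_lt_succ (μ : Measure Circle) (n : ℕ) :
    (monicOPUC μ n).degree < (n + 1 : ℕ) := by
  rw [degree_monicOPUC]; exact_mod_cast n.lt_succ_self

/-- A linear functional on polynomials of degree `< n` is determined by its values on
`Φ_0, …, Φ_{n-1}`. -/
lemma linearMap_eq_of_monicOPUC (μ : Measure Circle) {L₁ L₂ : ℂ[X] →ₗ[ℂ] ℂ} {n : ℕ}
    (h : ∀ j < n, L₁ (monicOPUC μ j) = L₂ (monicOPUC μ j)) {p : ℂ[X]} (hp : p.degree < n) :
    L₁ p = L₂ p := by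
  induction n generalizing p with
  | zero =>
    have : p = 0 := by simpa using hp
    simp [this]
  | succ n ih =>
    have key := ih (fun j hj => h j (by omega))
      (degree_sub_C_mul_lt hp (degree_monicOPUC_lt_succ μ n) (c := p.coeff n)
        (by rw [coeff_monicOPUC_self, mul_one]))
    rw [map_sub, map_sub, ← smul_eq_C_mul, map_smul, map_smul, h n n.lt_succ_self] at key
    exact sub_left_injective key

/-! ### Reversed polynomials -/

/-- The reversed polynomial `p^*(z) = z^n conj (p (1 / conj z))`. -/
noncomputable def starPoly (n : ℕ) (p : ℂ[X]) : ℂ[X] := (p.map (starRingEnd ℂ)).reflect n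

lemma coeff_starPoly (n : ℕ) (p : ℂ[X]) (k : ℕ) :
    (starPoly n p).coeff k = conj (p.coeff (revAt n k)) := by
  rw [starPoly, coeff_reflect, coeff_map]

lemma degree_starPoly_lt_succ {n : ℕ} {p : ℂ[X]} (hp : p.degree < (n + 1 : ℕ)) :
    (starPoly n p).degree < (n + 1 : ℕ) := by
  rw [degree_lt_iff_coeff_zero] at *
  intro m hm
  rw [coeff_starPoly, revAt_eq_self_of_lt (by omega), hp m hm, map_zero]

lemma eval_starPoly {n : ℕ} {p : ℂ[X]} (hp : p.degree < (n + 1 : ℕ)) (z : Circle) :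
    (starPoly n p).eval (z : ℂ) = (z : ℂ) ^ n * conj (p.eval (z : ℂ)) := by
  -- On the circle the inverse of `conj z` is `z`, so evaluating the reflected polynomial at `z` is
  -- an instance of `eval₂_reflect_mul_pow` at `conj z`.
  let _ : Invertible (conj (z : ℂ)) := ⟨z, circle_mul_conj z, circle_conj_mul z⟩
  have hn : p.natDegree ≤ n := by
    rw [natDegree_le_iff_coeff_eq_zero]
    rw [degree_lt_iff_coeff_zero] at hp
    exact hp
  have h := eval₂_reflect_mul_pow (RingHom.id ℂ) (conj (z : ℂ)) n (p.map (starRingEnd ℂ))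
    (natDegree_map_le.trans hn)
  have h2 : ⅟(conj (z : ℂ)) = (z : ℂ) := rfl
  rw [h2, eval₂_id, eval₂_id, eval_map, eval₂_at_apply] at h
  have h3 : conj (z : ℂ) ^ n * (z : ℂ) ^ n = 1 := by rw [← mul_pow, circle_conj_mul, one_pow]
  rw [starPoly, ← h]
  linear_combination (-eval (z : ℂ) (reflect n (p.map (starRingEnd ℂ)))) * h3

/-- Both integrands equal `z^n conj p conj q`, which is symmetric in `p` and `q`. -/
lemma ip_starPoly_left (μ : Measure Circle) {n : ℕ} {p q : ℂ[X]} (hp : p.degree < (n + 1 : ℕ))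
    (hq : q.degree < (n + 1 : ℕ)) : ip μ (starPoly n p) q = ip μ (starPoly n q) p := by
  rw [ip, ip]
  congr 1 with z
  rw [eval_starPoly hp, eval_starPoly hq]
  ring

lemma ip_starPoly_self (μ : Measure Circle) {n : ℕ} {p : ℂ[X]} (hp : p.degree < (n + 1 : ℕ)) :
    ip μ (starPoly n p) (starPoly n p) = ip μ p p := by
  rw [ip, ip]
  congr 1 with z
  rw [eval_starPoly hp]
  have h : (z : ℂ) ^ n * conj (z : ℂ) ^ n = 1 := by rw [← mul_pow, circle_mul_conj, one_pow]
  simp only [map_mul, map_pow, Complex.conj_conj]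
  linear_combination (p.eval (z : ℂ) * conj (p.eval (z : ℂ))) * h

lemma degree_X_mul_lt_succ {n : ℕ} {p : ℂ[X]} (hp : p.degree < n) :
    degree (X * p) < (n + 1 : ℕ) := by
  rw [degree_lt_iff_coeff_zero] at *
  intro m hm
  obtain ⟨m, rfl⟩ : ∃ k, m = k + 1 := ⟨m - 1, by omega⟩
  rw [coeff_X_mul, hp m (by omega)]

/-! ### Orthogonality -/

section Orthogonal

variable {μ : Measure Circle} [IsFiniteMeasure μ]

lemma ip_monicOPUC_self_ne_zero (hμ : μ.support.Infinite) (n : ℕ) :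
    ip μ (monicOPUC μ n) (monicOPUC μ n) ≠ 0 := fun h =>
  (monic_monicOPUC μ n).ne_zero (eq_zero_of_ip_self_eq_zero hμ h)

lemma ip_monicOPUC_of_lt (hμ : μ.support.Infinite) {n m : ℕ} (hm : m < n) :
    ip μ (monicOPUC μ n) (monicOPUC μ m) = 0 := by
  induction n using Nat.strong_induction_on generalizing m with
  | _ n ih =>
    rw [monicOPUC_eq, ip_sub_left, ← ipLeft_apply μ (∑ j : Fin n, _), map_sum,
      Finset.sum_eq_single (⟨m, hm⟩ : Fin n)]
    · rw [ipLeft_apply, ip_C_mul_left, div_mul_cancel₀ _ (ip_monicOPUC_self_ne_zero hμ m), sub_self]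
    · intro j _ hj
      have hjm : (j : ℕ) ≠ m := fun h => hj (Fin.ext h)
      rw [ipLeft_apply, ip_C_mul_left]
      rcases lt_or_gt_of_ne hjm with h | h
      · rw [ip_eq_zero_comm μ (ih m hm h), mul_zero]
      · rw [ih j j.2 h, mul_zero]
    · simp

lemma ip_monicOPUC_right_of_degree_lt (hμ : μ.support.Infinite) {n : ℕ} {p : ℂ[X]}
    (hp : p.degree < n) : ip μ p (monicOPUC μ n) = 0 := by
  have := linearMap_eq_of_monicOPUC μ (L₁ := ipLeft μ (monicOPUC μ n)) (L₂ := 0)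
    (fun j hj => by simpa using ip_eq_zero_comm μ (ip_monicOPUC_of_lt hμ hj)) hp
  simpa using this

lemma ip_monicOPUC_left_of_degree_lt (hμ : μ.support.Infinite) {n : ℕ} {p : ℂ[X]}
    (hp : p.degree < n) : ip μ (monicOPUC μ n) p = 0 :=
  ip_eq_zero_comm μ (ip_monicOPUC_right_of_degree_lt hμ hp)

variable (μ) in
/-- The squared norm `‖Φ_n‖²`. -/
noncomputable def normSqOPUC (n : ℕ) : ℝ := ∫ z : Circle, ‖(monicOPUC μ n).eval (z : ℂ)‖ ^ 2 ∂μ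

omit [IsFiniteMeasure μ] in
lemma ip_monicOPUC_self (n : ℕ) :
    ip μ (monicOPUC μ n) (monicOPUC μ n) = (normSqOPUC μ n : ℂ) :=
  ip_self_eq_integral μ _

lemma normSqOPUC_pos (hμ : μ.support.Infinite) (n : ℕ) : 0 < normSqOPUC μ n := by
  refine lt_of_le_of_ne (integral_nonneg fun z => by positivity) fun h => ?_
  refine ip_monicOPUC_self_ne_zero hμ n ?_
  rw [ip_monicOPUC_self, ← h, Complex.ofReal_zero]

/-! ### The Szegő recurrence -/

/-- Reversal exchanges the constant and the top coefficient, so `(X r)^*` has degree below `n` and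
is orthogonal to `Φ_n`. Thus `Φ_n^*` is orthogonal to `z, …, z^n`. -/
lemma ip_starPoly_monicOPUC_X_mul (hμ : μ.support.Infinite) {n : ℕ} {r : ℂ[X]} (hr : r.degree < n) :
    ip μ (starPoly n (monicOPUC μ n)) (X * r) = 0 := by
  rw [ip_starPoly_left μ (degree_monicOPUC_lt_succ μ n) (degree_X_mul_lt_succ hr)]
  refine ip_monicOPUC_right_of_degree_lt hμ ?_
  have h := degree_starPoly_lt_succ (degree_X_mul_lt_succ hr)
  rw [degree_lt_iff_coeff_zero] at *
  intro m hm
  rcases hm.eq_or_lt with rfl | hm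
  · rw [coeff_starPoly, revAt_le le_rfl, Nat.sub_self, coeff_X_mul_zero, map_zero]
  · exact h m hm

/-- The difference `f` of the two sides has degree at most `n` and vanishes at `0`, so `f = X g`
with `deg g < n`. All three terms of `f` are orthogonal to `X g`; hence `⟨f, f⟩ = 0`. -/
lemma X_mul_monicOPUC (hμ : μ.support.Infinite) (n : ℕ) :
    X * monicOPUC μ n =
      monicOPUC μ (n + 1) + C (conj (verblunsky μ n)) * starPoly n (monicOPUC μ n) := by
  set f := X * monicOPUC μ n - C 1 * monicOPUC μ (n + 1) -
    C (conj (verblunsky μ n)) * starPoly n (monicOPUC μ n) with hf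
  have hdeg : f.degree < (n + 1 : ℕ) := by
    refine (degree_sub_le _ _).trans_lt (max_lt ?_ ?_)
    · refine degree_sub_C_mul_lt (degree_X_mul_lt_succ (degree_monicOPUC_lt_succ μ n))
        (degree_monicOPUC_lt_succ μ (n + 1)) ?_
      rw [coeff_X_mul, coeff_monicOPUC_self, coeff_monicOPUC_self, one_mul]
    · rw [← smul_eq_C_mul]
      exact (degree_smul_le _ _).trans_lt
        (degree_starPoly_lt_succ (degree_monicOPUC_lt_succ μ n))
  have h0 : f.coeff 0 = 0 := by
    simp only [hf, coeff_sub, coeff_X_mul_zero, coeff_C_mul, coeff_starPoly, revAt_zero,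
      coeff_monicOPUC_self]
    simp [verblunsky, coeff_zero_eq_eval_zero]
  obtain ⟨g, hg⟩ := X_dvd_iff.2 h0
  have hgdeg : g.degree < n := by
    rw [degree_lt_iff_coeff_zero] at *
    intro m hm
    rw [← coeff_X_mul, ← hg, hdeg (m + 1) (by omega)]
  have hff : ip μ f f = 0 := by
    nth_rewrite 2 [hg]
    rw [hf, ip_sub_left, ip_sub_left, ip_C_mul_left, ip_C_mul_left, ip_X_mul_X_mul,
      ip_monicOPUC_left_of_degree_lt hμ hgdeg, ip_starPoly_monicOPUC_X_mul hμ hgdeg,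
      ip_monicOPUC_left_of_degree_lt hμ (degree_X_mul_lt_succ hgdeg)]
    ring
  have := eq_zero_of_ip_self_eq_zero hμ hff
  rw [hf, C_1, one_mul] at this
  linear_combination this

/-- Pythagoras in the Szegő recurrence: multiplication by `z` and reversal preserve the norm, and
`Φ_{n+1}` is orthogonal to `Φ_n^*`. -/
lemma normSqOPUC_succ (hμ : μ.support.Infinite) (n : ℕ) :
    normSqOPUC μ (n + 1) = (1 - ‖verblunsky μ n‖ ^ 2) * normSqOPUC μ n := by
  have hs := degree_starPoly_lt_succ (degree_monicOPUC_lt_succ μ n)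
  have h := ip_X_mul_X_mul μ (monicOPUC μ n) (monicOPUC μ n)
  rw [X_mul_monicOPUC hμ n, ip_add_left, ip_add_right, ip_add_right, ip_C_mul_left, ip_C_mul_left,
    ip_C_mul_right, ip_C_mul_right, ip_starPoly_self μ (degree_monicOPUC_lt_succ μ n),
    ip_monicOPUC_left_of_degree_lt hμ hs, ip_monicOPUC_right_of_degree_lt hμ hs,
    ip_monicOPUC_self, ip_monicOPUC_self, Complex.conj_conj] at h
  have hα := Complex.conj_mul' (verblunsky μ n)
  have : (normSqOPUC μ (n + 1) : ℂ) = (1 - ‖verblunsky μ n‖ ^ 2 : ℝ) * normSqOPUC μ n := by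
    push_cast
    linear_combination h - (normSqOPUC μ n : ℂ) * hα
  exact_mod_cast this

lemma norm_verblunsky_lt_one (hμ : μ.support.Infinite) (n : ℕ) : ‖verblunsky μ n‖ < 1 := by
  have h := normSqOPUC_succ hμ n
  have h1 : 0 < 1 - ‖verblunsky μ n‖ ^ 2 :=
    pos_of_mul_pos_left (h ▸ normSqOPUC_pos hμ (n + 1)) (normSqOPUC_pos hμ n).le
  nlinarith [norm_nonneg (verblunsky μ n)]

lemma eval_monicOPUC_succ (hμ : μ.support.Infinite) (n : ℕ) (z : Circle) :
    (monicOPUC μ (n + 1)).eval (z : ℂ) = z * (monicOPUC μ n).eval (z : ℂ) -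
      conj (verblunsky μ n) * (z ^ n * conj ((monicOPUC μ n).eval (z : ℂ))) := by
  have h := congrArg (eval (z : ℂ)) (X_mul_monicOPUC hμ n)
  simp only [eval_mul, eval_add, eval_X, eval_C,
    eval_starPoly (degree_monicOPUC_lt_succ μ n)] at h
  linear_combination -h

end Orthogonal

/-! ### The Christoffel–Darboux kernel -/

section Kernel

variable (μ : Measure Circle)

/-- The reproducing kernel `K_n(·, w) = ∑_{j ≤ n} Φ_j conj (Φ_j(w)) / ‖Φ_j‖²`. -/
noncomputable def kern (w : Circle) (n : ℕ) : ℂ[X] :=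
  ∑ j ∈ Finset.range (n + 1),
    C (conj ((monicOPUC μ j).eval (w : ℂ)) / (normSqOPUC μ j : ℂ)) * monicOPUC μ j

lemma kern_zero (w : Circle) : kern μ w 0 = C (1 / (normSqOPUC μ 0 : ℂ)) := by
  simp [kern]

lemma kern_succ (w : Circle) (n : ℕ) : kern μ w (n + 1) = kern μ w n +
    C (conj ((monicOPUC μ (n + 1)).eval (w : ℂ)) / (normSqOPUC μ (n + 1) : ℂ)) *
      monicOPUC μ (n + 1) :=
  Finset.sum_range_succ _ _

lemma degree_kern_lt (w : Circle) (n : ℕ) : degree (kern μ w n) < (n + 1 : ℕ) := by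
  refine (degree_sum_le _ _).trans_lt ((Finset.sup_lt_iff (WithBot.bot_lt_coe _)).2 fun j hj => ?_)
  rw [← smul_eq_C_mul]
  refine (degree_smul_le _ _).trans_lt ?_
  rw [degree_monicOPUC]
  exact_mod_cast Finset.mem_range.1 hj

variable {μ} [IsFiniteMeasure μ]

lemma ip_sum_right {ι : Type*} (s : Finset ι) (f : ι → ℂ[X]) (p : ℂ[X]) :
    ip μ p (∑ j ∈ s, f j) = ∑ j ∈ s, ip μ p (f j) := by
  rw [← conj_ip, ← ipLeft_apply, map_sum, map_sum]
  simp only [ipLeft_apply, conj_ip]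

lemma ip_kern (hμ : μ.support.Infinite) (w : Circle) {n : ℕ} {p : ℂ[X]}
    (hp : p.degree < (n + 1 : ℕ)) : ip μ p (kern μ w n) = p.eval (w : ℂ) := by
  refine linearMap_eq_of_monicOPUC μ (L₁ := ipLeft μ (kern μ w n)) (L₂ := leval (w : ℂ))
    (fun j hj => ?_) hp
  rw [ipLeft_apply, kern, ip_sum_right, leval_apply,
    Finset.sum_eq_single_of_mem j (Finset.mem_range.2 hj)]
  · have : (normSqOPUC μ j : ℂ) ≠ 0 := by exact_mod_cast (normSqOPUC_pos hμ j).ne'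
    rw [ip_C_mul_right, ip_monicOPUC_self, map_div₀, Complex.conj_conj, Complex.conj_ofReal,
      div_mul_cancel₀ _ this]
  · intro i _ hij
    rw [ip_C_mul_right]
    rcases lt_or_gt_of_ne hij with h | h
    · rw [ip_monicOPUC_of_lt hμ h, mul_zero]
    · rw [ip_eq_zero_comm μ (ip_monicOPUC_of_lt hμ h), mul_zero]

/-! ### The form twisted by a linear factor at each end of an arc -/

variable (μ) in
/-- The form `⟨(z - z₁) p, (z - w) q⟩`. -/
noncomputable def twistedForm (z₁ w : Circle) (p q : ℂ[X]) : ℂ :=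
  ip μ ((X - C (z₁ : ℂ)) * p) ((X - C (w : ℂ)) * q)

lemma coeff_X_sub_C_mul (a : ℂ) (p : ℂ[X]) (n : ℕ) :
    ((X - C a) * p).coeff (n + 1) = p.coeff n - a * p.coeff (n + 1) := by
  rw [sub_mul, coeff_sub, coeff_X_mul, coeff_C_mul]

lemma degree_X_sub_C_mul_lt_succ (a : ℂ) {n : ℕ} {p : ℂ[X]} (hp : p.degree < n) :
    degree ((X - C a) * p) < (n + 1 : ℕ) := by
  rw [degree_lt_iff_coeff_zero] at *
  intro m hm
  obtain ⟨m, rfl⟩ : ∃ k, m = k + 1 := ⟨m - 1, by omega⟩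
  rw [coeff_X_sub_C_mul, hp m (by omega), hp (m + 1) (by omega), mul_zero, sub_zero]

lemma degree_lt_of_X_sub_C_mul {a : ℂ} {n : ℕ} {p : ℂ[X]}
    (hp : degree ((X - C a) * p) < (n + 1 : ℕ)) : p.degree < n := by
  rw [degree_mul, degree_X_sub_C] at hp
  by_cases h0 : p = 0
  · simp [h0]
  rw [degree_eq_natDegree h0] at *
  have : 1 + p.natDegree < n + 1 := by exact_mod_cast hp
  exact_mod_cast (by omega : p.natDegree < n)

/-- The orthogonal polynomials of the twisted form (Christoffel's formula). -/
lemma exists_twisted_orthogonal (hμ : μ.support.Infinite) (z₁ w : Circle) (n : ℕ) :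
    ∃ p : ℂ[X], p.degree < (n + 1 : ℕ) ∧ p.coeff n = (kern μ w n).eval (z₁ : ℂ) ∧
      (∀ q : ℂ[X], q.degree < n → twistedForm μ z₁ w p q = 0) ∧
      twistedForm μ z₁ w p p = conj ((kern μ w n).eval (z₁ : ℂ)) *
        (kern μ w (n + 1)).eval (z₁ : ℂ) * normSqOPUC μ (n + 1) := by
  set k := (kern μ w n).eval (z₁ : ℂ) with hk
  set φ := (monicOPUC μ (n + 1)).eval (z₁ : ℂ) with hφ
  -- This combination vanishes at `z₁` by design; `p` is its quotient by `X - z₁`, with top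
  -- coefficient `k`.
  set F := C k * monicOPUC μ (n + 1) - C φ * kern μ w n with hF
  have hker := degree_kern_lt μ w n
  have hroot : F.IsRoot (z₁ : ℂ) := by
    simp only [hF, IsRoot, eval_sub, eval_mul, eval_C, ← hk, ← hφ]
    ring
  obtain ⟨p, hp⟩ := dvd_iff_isRoot.2 hroot
  have hFdeg : F.degree < (n + 1 + 1 : ℕ) := by
    refine (degree_sub_le _ _).trans_lt (max_lt ?_ ?_)
    · rw [← smul_eq_C_mul]
      exact (degree_smul_le _ _).trans_lt (degree_monicOPUC_lt_succ μ (n + 1))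
    · rw [← smul_eq_C_mul]
      exact (degree_smul_le _ _).trans_lt (degree_lt_succ hker)
  have hpdeg : p.degree < (n + 1 : ℕ) := degree_lt_of_X_sub_C_mul (hp ▸ hFdeg)
  have hcoeff : p.coeff n = k := by
    have h := coeff_X_sub_C_mul (z₁ : ℂ) p n
    rw [← hp, (degree_lt_iff_coeff_zero _ _).1 hpdeg (n + 1) le_rfl, mul_zero, sub_zero] at h
    rw [← h, hF, coeff_sub, coeff_C_mul, coeff_C_mul, coeff_monicOPUC_self,
      (degree_lt_iff_coeff_zero _ _).1 hker (n + 1) le_rfl, mul_one, mul_zero, sub_zero]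
  have hform : ∀ r : ℂ[X], twistedForm μ z₁ w p r =
      k * ip μ (monicOPUC μ (n + 1)) ((X - C (w : ℂ)) * r) -
        φ * ip μ (kern μ w n) ((X - C (w : ℂ)) * r) := fun r => by
    rw [twistedForm, ← hp, hF, ip_sub_left, ip_C_mul_left, ip_C_mul_left]
  refine ⟨p, hpdeg, hcoeff, fun q hq => ?_, ?_⟩
  -- `(X - w) q` has degree at most `n`, so it is orthogonal to `Φ_{n+1}`, and its product with the
  -- kernel is its value at `w`, up to conjugation, which is zero.
  · have hd := degree_X_sub_C_mul_lt_succ (w : ℂ) hq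
    rw [hform, ip_monicOPUC_left_of_degree_lt hμ hd, ← conj_ip, ip_kern hμ w hd]
    simp
  -- Split off the top term of `(X - w) p`. The kernel then sees only `r(w) = -k Φ_{n+1}(w)`, and
  -- this contribution completes `K_n(z₁, w)` to `K_{n+1}(z₁, w)`.
  · set r := (X - C (w : ℂ)) * p - C k * monicOPUC μ (n + 1) with hr
    have hrdeg : r.degree < (n + 1 : ℕ) := by
      refine degree_sub_C_mul_lt (degree_X_sub_C_mul_lt_succ (w : ℂ) hpdeg)
        (degree_monicOPUC_lt_succ μ (n + 1)) ?_
      rw [coeff_X_sub_C_mul, coeff_monicOPUC_self, hcoeff,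
        (degree_lt_iff_coeff_zero _ _).1 hpdeg (n + 1) le_rfl, mul_one, mul_zero, sub_zero]
    have hsplit : (X - C (w : ℂ)) * p = C k * monicOPUC μ (n + 1) + r := by rw [hr]; ring
    have hrw : r.eval (w : ℂ) = -(k * (monicOPUC μ (n + 1)).eval (w : ℂ)) := by
      rw [hr]; simp
    rw [hform, hsplit, ip_add_right, ip_add_right, ip_C_mul_right, ip_C_mul_right,
      ip_monicOPUC_self, ip_monicOPUC_left_of_degree_lt hμ hrdeg,
      ip_monicOPUC_right_of_degree_lt hμ hker, ← conj_ip μ r, ip_kern hμ w hrdeg, hrw,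
      kern_succ, eval_add, eval_mul, eval_C, ← hk, ← hφ, map_neg, map_mul]
    have : (normSqOPUC μ (n + 1) : ℂ) ≠ 0 := by exact_mod_cast (normSqOPUC_pos hμ (n + 1)).ne'
    field_simp
    ring

end Kernel

/-! ### Weighted forms and the support -/

section Weight

/-- The star subalgebra of Laurent polynomials on the circle. -/
noncomputable def laurentSubalgebra : StarSubalgebra ℂ C(Circle, ℂ) :=
  StarAlgebra.adjoin ℂ {⟨fun z : Circle => (z : ℂ), continuous_induced_dom⟩}

lemma dense_laurentSubalgebra : laurentSubalgebra.topologicalClosure = ⊤ := by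
  refine ContinuousMap.starSubalgebra_topologicalClosure_eq_top_of_separatesPoints _ ?_
  intro x y hxy
  exact ⟨_, ⟨_, StarAlgebra.self_mem_adjoin_singleton ℂ _, rfl⟩,
    fun h => hxy (Circle.coe_injective h)⟩

/-- A power of `z` clears the negative exponents. Since it has modulus one on the circle, `|f|²`
equals `|p|²` there. -/
lemma exists_poly_of_mem_laurentSubalgebra {f : C(Circle, ℂ)} (hf : f ∈ laurentSubalgebra) :
    ∃ (p : ℂ[X]) (N : ℕ), ∀ z : Circle, (z : ℂ) ^ N * f z = p.eval (z : ℂ) := by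
  induction hf using StarAlgebra.adjoin_induction with
  | mem f hf =>
    rw [Set.mem_singleton_iff] at hf
    exact ⟨X, 0, fun z => by simp [hf]; rfl⟩
  | algebraMap r => exact ⟨C r, 0, fun z => by simp⟩
  | add f g _ _ hf hg =>
    obtain ⟨p, N, hp⟩ := hf
    obtain ⟨q, M, hq⟩ := hg
    refine ⟨X ^ M * p + X ^ N * q, N + M, fun z => ?_⟩
    simp only [eval_add, eval_mul, eval_pow, eval_X, ← hp, ← hq, ContinuousMap.add_apply]
    ring
  | mul f g _ _ hf hg =>
    obtain ⟨p, N, hp⟩ := hf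
    obtain ⟨q, M, hq⟩ := hg
    refine ⟨p * q, N + M, fun z => ?_⟩
    simp only [eval_mul, ← hp, ← hq, ContinuousMap.mul_apply]
    ring
  | star f _ hf =>
    obtain ⟨p, N, hp⟩ := hf
    refine ⟨X ^ N * starPoly p.natDegree p, p.natDegree, fun z => ?_⟩
    have hdeg : p.degree < (p.natDegree + 1 : ℕ) :=
      degree_le_natDegree.trans_lt (by exact_mod_cast p.natDegree.lt_succ_self)
    have hz : (z : ℂ) ^ N * conj (z : ℂ) ^ N = 1 := by rw [← mul_pow, circle_mul_conj, one_pow]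
    rw [eval_mul, eval_pow, eval_X, eval_starPoly hdeg, ← hp, map_mul, map_pow,
      ContinuousMap.star_apply, Complex.star_def]
    linear_combination (-((z : ℂ) ^ p.natDegree * conj (f z))) * hz

variable {μ : Measure Circle} [IsFiniteMeasure μ]

lemma continuous_integral_circle : Continuous fun f : C(Circle, ℝ) => ∫ z, f z ∂μ := by
  have h : (fun f : C(Circle, ℝ) => ∫ z, f z ∂μ) =
      fun f => ∫ z, ContinuousMap.toLp (E := ℝ) 1 μ ℝ f z ∂μ :=
    funext fun f => (integral_congr_ae (ContinuousMap.coeFn_toLp μ f)).symm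
  rw [h]
  exact continuous_integral.comp (ContinuousMap.toLp (E := ℝ) 1 μ ℝ).continuous

/-- If a weight gives a positive semidefinite form on polynomials, then it does so on all continuous
functions. -/
lemma integral_norm_sq_mul_nonneg {s : C(Circle, ℝ)}
    (h : ∀ p : ℂ[X], 0 ≤ ∫ z : Circle, ‖p.eval (z : ℂ)‖ ^ 2 * s z ∂μ) (f : C(Circle, ℂ)) :
    0 ≤ ∫ z, ‖f z‖ ^ 2 * s z ∂μ := by
  let Ψ : C(Circle, ℂ) → C(Circle, ℝ) := fun f =>
    (ContinuousMap.comp ⟨fun c : ℂ => ‖c‖ ^ 2, by fun_prop⟩ f) * s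
  have hΨ : Continuous Ψ := (ContinuousMap.continuous_postcomp _).mul continuous_const
  have hcl : IsClosed {f : C(Circle, ℂ) | 0 ≤ ∫ z, Ψ f z ∂μ} :=
    isClosed_le continuous_const (continuous_integral_circle.comp hΨ)
  have hsub : (laurentSubalgebra : Set C(Circle, ℂ)) ⊆ {f | 0 ≤ ∫ z, Ψ f z ∂μ} := by
    intro g hg
    obtain ⟨p, N, hp⟩ := exists_poly_of_mem_laurentSubalgebra hg
    have e : (fun z => Ψ g z) = fun z : Circle => ‖p.eval (z : ℂ)‖ ^ 2 * s z := by
      funext z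
      rw [← hp, norm_mul, norm_pow, Circle.norm_coe, one_pow, one_mul]
      rfl
    rw [Set.mem_ofPred_eq, e]
    exact h p
  have hf : f ∈ laurentSubalgebra.topologicalClosure := by
    rw [dense_laurentSubalgebra]; trivial
  exact hcl.closure_subset_iff.2 hsub hf

/-- Test against the negative part `s⁻`: the integrand is `-(s⁻)³ ≤ 0`, so its integral must vanish,
and with it `s⁻` on the support. -/
lemma nonneg_on_support_of_form_nonneg {s : C(Circle, ℝ)}
    (h : ∀ p : ℂ[X], 0 ≤ ∫ z : Circle, ‖p.eval (z : ℂ)‖ ^ 2 * s z ∂μ) {z : Circle}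
    (hz : z ∈ μ.support) : 0 ≤ s z := by
  by_contra! hneg
  let f : C(Circle, ℂ) := ⟨fun z => ((max (-s z) 0 : ℝ) : ℂ), by fun_prop⟩
  have hf : ∀ z, ‖f z‖ ^ 2 * s z = -(max (-s z) 0) ^ 3 := by
    intro z
    have : ‖f z‖ = max (-s z) 0 := by
      change ‖((max (-s z) 0 : ℝ) : ℂ)‖ = _
      rw [Complex.norm_real, Real.norm_of_nonneg (le_max_right _ _)]
    rw [this]
    rcases le_total (s z) 0 with h0 | h0
    · rw [max_eq_left (by linarith)]; ring
    · rw [max_eq_right (by linarith)]; ring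
  have h1 := integral_norm_sq_mul_nonneg h f
  simp only [hf] at h1
  rw [integral_neg] at h1
  have h2 : ∫ z, (max (-s z) 0) ^ 3 ∂μ = 0 :=
    le_antisymm (by linarith) (integral_nonneg fun z => by positivity)
  have h3 := eq_zero_of_mem_support_of_integral_eq_zero (f := fun z => (max (-s z) 0) ^ 3)
    (by fun_prop) (fun _ _ => by positivity) h2 hz
  have h4 : 0 < max (-s z) 0 := lt_max_of_lt_left (by linarith)
  exact (pow_pos h4 3).ne' h3

/-- If the integral were zero, the finitely many zeros of `p` and `s` would cover the infinite
support. -/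
lemma form_pos_of_nonneg_on_support (hμ : μ.support.Infinite) {s : C(Circle, ℝ)}
    (hs : ∀ z ∈ μ.support, 0 ≤ s z) (hfin : {z | s z = 0}.Finite) {p : ℂ[X]} (hp : p ≠ 0) :
    0 < ∫ z : Circle, ‖p.eval (z : ℂ)‖ ^ 2 * s z ∂μ := by
  have hcont : Continuous fun z : Circle => ‖p.eval (z : ℂ)‖ ^ 2 * s z :=
    ((continuous_eval_circle p).norm.pow 2).mul s.continuous
  have hnn : ∀ z ∈ μ.support, 0 ≤ ‖p.eval (z : ℂ)‖ ^ 2 * s z := fun z hz =>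
    mul_nonneg (by positivity) (hs z hz)
  have hae : ∀ᵐ z ∂μ, z ∈ μ.support := Measure.support_mem_ae
  refine lt_of_le_of_ne (integral_nonneg_of_ae (hae.mono hnn)) fun h0 => ?_
  refine (hμ.sdiff hfin) (Set.Finite.subset (Set.Finite.preimage
    Circle.coe_injective.injOn (p.rootSet_finite ℂ)) fun z hz => ?_)
  have h1 := eq_zero_of_mem_support_of_integral_eq_zero hcont hnn h0.symm hz.1
  rcases mul_eq_zero.1 h1 with h2 | h2
  · rw [Set.mem_preimage, mem_rootSet]
    exact ⟨hp, by simpa using h2⟩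
  · exact (hz.2 h2).elim

end Weight

/-! ### Chain sequences -/

/-- A minimal parameter sequence lies in `(0, 1)` exactly when the associated solution of the
three-term recurrence alternates in sign. -/
lemma alternating_iff_chain {G y V m : ℕ → ℝ} (hG : ∀ n, 0 < G n ∧ G n < 1) (hV0 : 0 < V 0)
    (hV1 : (1 - G 0) * V 1 = y 0 * V 0)
    (hV : ∀ n, (1 - G (n + 1)) * V (n + 2) = y (n + 1) * V (n + 1) - G (n + 1) * V n)
    (hm0 : m 0 = 0)
    (hm : ∀ n, m (n + 1) = (1 - G n) * G (n + 1) / (y n * y (n + 1)) / (1 - m n)) :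
    (∀ n, V n * V (n + 1) < 0) ↔ y 0 < 0 ∧ ∀ n, 1 ≤ n → 0 < m n ∧ m n < 1 := by
  -- The ratio formula for `1 - m n` is the invariant of both directions; dividing the recurrence
  -- for `V` by `y (n + 1) * V (n + 1)` propagates it.
  have step : ∀ n, y n < 0 → y (n + 1) < 0 → V n * V (n + 1) < 0 →
      1 - m n = (1 - G n) * V (n + 1) / (y n * V n) →
      1 - m (n + 1) = (1 - G (n + 1)) * V (n + 2) / (y (n + 1) * V (n + 1)) := by
    intro n hy hy' hVV h
    have h1 : V n ≠ 0 := left_ne_zero_of_mul hVV.ne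
    have h2 : V (n + 1) ≠ 0 := right_ne_zero_of_mul hVV.ne
    have h3 : 1 - G n ≠ 0 := by linarith [(hG n).2]
    rw [hm, h, hV]
    have := hy.ne
    have := hy'.ne
    field_simp
  have pos : ∀ n, y n < 0 → V n * V (n + 1) < 0 →
      0 < (1 - G n) * V (n + 1) / (y n * V n) := by
    intro n hy hVV
    have h1 : V n ≠ 0 := left_ne_zero_of_mul hVV.ne
    have h2 := mul_pos_of_neg_of_neg hy hVV
    have h3 : (1 - G n) * V (n + 1) / (y n * V n) =
        (1 - G n) * (y n * (V n * V (n + 1))) / (y n * V n) ^ 2 := by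
      have := hy.ne
      field_simp
    rw [h3]
    have := hy.ne
    have := (hG n).2
    exact div_pos (mul_pos (by linarith) h2) (by positivity)
  constructor
  · intro h
    have hy : ∀ n, y n < 0 := by
      intro n
      cases n with
      | zero =>
        have h0 := h 0
        have h1 : V 1 < 0 := by
          by_contra! h1
          nlinarith
        by_contra! h2
        nlinarith [hG 0, mul_nonneg h2 hV0.le,
          mul_pos_of_neg_of_neg h1 (by linarith [hG 0] : -(1 - G 0) < 0)]
      | succ n =>
        -- The recurrence multiplied by `V (n + 1)`: two sign changes on the right force `y (n + 1)
        -- < 0`.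
        have e : y (n + 1) * V (n + 1) ^ 2 =
            (1 - G (n + 1)) * (V (n + 1) * V (n + 2)) + G (n + 1) * (V n * V (n + 1)) := by
          linear_combination (-V (n + 1)) * hV n
        have e1 : (1 - G (n + 1)) * (V (n + 1) * V (n + 2)) < 0 :=
          mul_neg_of_pos_of_neg (by linarith [hG (n + 1)]) (h (n + 1))
        have e2 : G (n + 1) * (V n * V (n + 1)) < 0 :=
          mul_neg_of_pos_of_neg (hG (n + 1)).1 (h n)
        exact neg_of_mul_neg_left (by rw [e]; linarith) (sq_nonneg (V (n + 1)))
    have key : ∀ n, 1 - m n = (1 - G n) * V (n + 1) / (y n * V n) := by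
      intro n
      induction n with
      | zero =>
        rw [hm0, hV1, sub_zero, div_self (mul_ne_zero (hy 0).ne hV0.ne')]
      | succ n ih => exact step n (hy n) (hy (n + 1)) (h n) ih
    have hlt : ∀ n, 0 < 1 - m n := fun n => by rw [key]; exact pos n (hy n) (h n)
    refine ⟨hy 0, fun n hn => ⟨?_, by linarith [hlt n]⟩⟩
    obtain ⟨n, rfl⟩ : ∃ k, n = k + 1 := ⟨n - 1, by omega⟩
    rw [hm]
    have := hG n
    have := hG (n + 1)
    exact div_pos (div_pos (mul_pos (by linarith) (by linarith))
      (mul_pos_of_neg_of_neg (hy n) (hy (n + 1)))) (hlt n)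
  · rintro ⟨hy0, h⟩
    have key : ∀ n, y n < 0 ∧ V n * V (n + 1) < 0 ∧
        1 - m n = (1 - G n) * V (n + 1) / (y n * V n) := by
      intro n
      induction n with
      | zero =>
        refine ⟨hy0, ?_, ?_⟩
        · have h1 : (1 - G 0) * V 1 < 0 := hV1 ▸ mul_neg_of_neg_of_pos hy0 hV0
          exact mul_neg_of_pos_of_neg hV0 (neg_of_mul_neg_right h1 (by linarith [hG 0]))
        · rw [hm0, hV1, sub_zero, div_self (mul_ne_zero hy0.ne hV0.ne')]
      | succ n ih =>
        obtain ⟨hy, hVV, hmn⟩ := ih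
        have hpos : 0 < 1 - m n := hmn ▸ pos n hy hVV
        have hm1 := (h (n + 1) (by omega)).1
        have hm2 := (h (n + 1) (by omega)).2
        rw [hm] at hm1
        -- Positivity of `m (n + 1)` makes `y` keep its sign. It also excludes `y (n + 1) = 0`,
        -- since division by zero would give `m (n + 1) = 0`.
        have hy' : y (n + 1) < 0 := by
          have h1 : 0 < (1 - G n) * G (n + 1) / (y n * y (n + 1)) :=
            (div_pos_iff_of_pos_right hpos).1 hm1
          have h2 : 0 < (1 - G n) * G (n + 1) := mul_pos (by linarith [hG n]) (hG (n + 1)).1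
          have h3 : 0 < y n * y (n + 1) := (div_pos_iff_of_pos_left h2).1 h1
          exact neg_of_mul_pos_right h3 hy.le
        have hstep := step n hy hy' hVV hmn
        refine ⟨hy', ?_, hstep⟩
        -- Here `m (n + 1) < 1` enters: with `y (n + 1) < 0`, a positive ratio means that `V`
        -- changes sign.
        have h4 : 0 < (1 - G (n + 1)) * V (n + 2) / (y (n + 1) * V (n + 1)) := by
          rw [← hstep]; linarith
        have hne : V (n + 1) ≠ 0 := right_ne_zero_of_mul hVV.ne
        have h5 : 0 < (1 - G (n + 1)) * V (n + 2) * (y (n + 1) * V (n + 1)) := by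
          have := hy'.ne
          have h6 : 0 < (y (n + 1) * V (n + 1)) ^ 2 := by positivity
          have h7 := mul_pos h4 h6
          rwa [div_mul_eq_mul_div, sq, ← mul_assoc, mul_div_assoc, div_self (by positivity),
            mul_one] at h7
        have h8 : 0 < ((1 - G (n + 1)) * y (n + 1)) * (V (n + 1) * V (n + 2)) := by
          linarith
        exact neg_of_mul_pos_right h8
          (mul_nonpos_of_nonneg_of_nonpos (by linarith [hG (n + 1)]) hy'.le)
    exact fun n => (key n).2.1

/-! ### The three-term recurrence of the kernel -/

section Recurrence

variable {μ : Measure Circle} [IsFiniteMeasure μ]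

/-- Each step multiplies `τ` by `e^{iϑ}` and by a quotient `conj u / u`, both of modulus one. -/
lemma norm_tau {α : ℕ → ℂ} (hα : ∀ n, ‖α n‖ < 1) (ϑ : ℝ) (n : ℕ) : ‖tau α ϑ n‖ = 1 := by
  induction n with
  | zero => rw [tau, mul_comm, Complex.norm_exp_ofReal_mul_I]
  | succ n ih =>
    have hne : 1 - tau α ϑ n * α n ≠ 0 := by
      intro h
      have : ‖tau α ϑ n * α n‖ = 1 := by rw [← sub_eq_zero.1 h, norm_one]
      rw [norm_mul, ih, one_mul] at this
      exact (hα n).ne this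
    have hc : 1 - conj (tau α ϑ n * α n) = conj (1 - tau α ϑ n * α n) := by
      rw [map_sub, map_one]
    rw [tau, norm_mul, norm_mul, ih, hc, norm_div, Complex.norm_conj,
      div_self (norm_ne_zero_iff.2 hne), mul_comm Complex.I, Complex.norm_exp_ofReal_mul_I]
    norm_num

lemma norm_tau_mul_lt_one {α : ℕ → ℂ} (hα : ∀ n, ‖α n‖ < 1) (ϑ : ℝ) (n : ℕ) :
    ‖tau α ϑ n * α n‖ < 1 := by
  rw [norm_mul, norm_tau hα, one_mul]; exact hα n

lemma one_sub_ne_zero_of_norm_lt_one {a : ℂ} (ha : ‖a‖ < 1) : 1 - a ≠ 0 := by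
  intro h
  rw [← sub_eq_zero.1 h, norm_one] at ha
  exact lt_irrefl _ ha

lemma coe_exp_eq (ϑ : ℝ) : ((Circle.exp ϑ : Circle) : ℂ) = Complex.exp (Complex.I * ϑ) := by
  rw [Circle.coe_exp, mul_comm]

lemma star_monicOPUC_succ (hμ : μ.support.Infinite) (n : ℕ) (u : Circle) :
    (u : ℂ) ^ (n + 1) * conj ((monicOPUC μ (n + 1)).eval (u : ℂ)) =
      u ^ n * conj ((monicOPUC μ n).eval (u : ℂ)) -
        verblunsky μ n * (u * (monicOPUC μ n).eval (u : ℂ)) := by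
  have hu := circle_mul_conj u
  have hun : (u : ℂ) ^ n * conj (u : ℂ) ^ n = 1 := by rw [← mul_pow, hu, one_pow]
  rw [eval_monicOPUC_succ hμ n u]
  simp only [map_sub, map_mul, map_pow, Complex.conj_conj]
  rw [pow_succ]
  linear_combination ((u : ℂ) ^ n * conj ((monicOPUC μ n).eval (u : ℂ))) * hu -
    verblunsky μ n * u * (monicOPUC μ n).eval (u : ℂ) * hun

/-- `τ_n = w Φ_n(w) / Φ_n^*(w)`, where `Φ_n^*(w) ≠ 0`. -/
lemma tau_mul_star (hμ : μ.support.Infinite) (ϑ : ℝ) (n : ℕ) :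
    (monicOPUC μ n).eval (Circle.exp ϑ : ℂ) ≠ 0 ∧
    (Circle.exp ϑ : ℂ) * (monicOPUC μ n).eval (Circle.exp ϑ : ℂ) =
      tau (verblunsky μ) ϑ n *
        ((Circle.exp ϑ : ℂ) ^ n * conj ((monicOPUC μ n).eval (Circle.exp ϑ : ℂ))) := by
  set w := Circle.exp ϑ with hw
  have hwc := circle_mul_conj w
  have hw0 : (w : ℂ) ≠ 0 := left_ne_zero_of_mul_eq_one hwc
  have hα := norm_verblunsky_lt_one hμ
  induction n with
  | zero =>
    rw [tau, ← coe_exp_eq, ← hw]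
    simp
  | succ n ih =>
    obtain ⟨h0, h⟩ := ih
    have ha := one_sub_ne_zero_of_norm_lt_one (norm_tau_mul_lt_one hα ϑ n)
    have hS := eval_monicOPUC_succ hμ n w
    set A := (monicOPUC μ n).eval (w : ℂ)
    set α := verblunsky μ n
    set τ := tau (verblunsky μ) ϑ n with hτ
    have hττ : τ * conj τ = 1 := by
      rw [Complex.mul_conj', norm_tau hα]; norm_num
    -- At `w` the reversed recurrence reads `Φ_{n+1}^* = (1 - τ_n α_n) Φ_n^*`, and `|τ_n α_n| < 1`
    -- keeps it nonzero.
    have hb : (w : ℂ) ^ (n + 1) * conj ((monicOPUC μ (n + 1)).eval (w : ℂ)) =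
        (1 - τ * α) * (w ^ n * conj A) := by
      rw [star_monicOPUC_succ hμ n w]
      linear_combination (-α) * h
    have hA : (monicOPUC μ (n + 1)).eval (w : ℂ) =
        (τ - conj α) * (w ^ n * conj A) := by
      rw [hS]; linear_combination h
    constructor
    · intro hz
      rw [hz, map_zero, mul_zero] at hb
      refine mul_ne_zero ha (mul_ne_zero (pow_ne_zero n hw0) ?_) hb.symm
      rwa [Ne, map_eq_zero]
    · rw [hb, hA, tau, ← coe_exp_eq, ← hw, ← hτ, map_mul]
      change _ = w * τ * ((1 - conj τ * conj α) / (1 - τ * α)) * _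
      field_simp
      linear_combination (conj α * conj A) * hττ

/-- The Christoffel–Darboux formula. -/
lemma one_sub_mul_kern (hμ : μ.support.Infinite) (z w : Circle) (n : ℕ) :
    (1 - z * conj (w : ℂ)) * normSqOPUC μ n * (kern μ w n).eval (z : ℂ) =
      (z ^ n * conj ((monicOPUC μ n).eval (z : ℂ))) *
          conj (w ^ n * conj ((monicOPUC μ n).eval (w : ℂ))) -
        z * conj (w : ℂ) * (monicOPUC μ n).eval (z : ℂ) *
          conj ((monicOPUC μ n).eval (w : ℂ)) := by
  have hnz : ∀ n, (normSqOPUC μ n : ℂ) ≠ 0 := fun n => by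
    exact_mod_cast (normSqOPUC_pos hμ n).ne'
  induction n with
  | zero =>
    rw [kern_zero]
    have := hnz 0
    simp
    field_simp
  | succ n ih =>
    have hN : (normSqOPUC μ (n + 1) : ℂ) =
        (1 - conj (verblunsky μ n) * verblunsky μ n) * normSqOPUC μ n := by
      rw [normSqOPUC_succ hμ, Complex.conj_mul']; push_cast; ring
    -- The factor `1 - |α_n|²` accounts for the change of norm; after this the inductive step is
    -- algebra in the Szegő recurrence.
    have e : (1 - z * conj (w : ℂ)) * normSqOPUC μ (n + 1) * (kern μ w (n + 1)).eval (z : ℂ) =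
        (1 - conj (verblunsky μ n) * verblunsky μ n) *
          ((1 - z * conj (w : ℂ)) * normSqOPUC μ n * (kern μ w n).eval (z : ℂ)) +
        (1 - z * conj (w : ℂ)) * (monicOPUC μ (n + 1)).eval (z : ℂ) *
          conj ((monicOPUC μ (n + 1)).eval (w : ℂ)) := by
      rw [kern_succ, eval_add, eval_mul, eval_C]
      have := hnz (n + 1)
      field_simp
      rw [hN]
      ring
    rw [e, ih, star_monicOPUC_succ hμ n z, star_monicOPUC_succ hμ n w,
      eval_monicOPUC_succ hμ n z, eval_monicOPUC_succ hμ n w]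
    simp only [map_sub, map_mul, map_pow, Complex.conj_conj]
    ring

/-- The three-term recurrence of `K_n(z, w)`, with `K_{n-1}(z, w)` written as
`K_n(z, w) - Φ_n(z) conj (Φ_n(w)) / ‖Φ_n‖²`. -/
lemma kern_recurrence_aux (hμ : μ.support.Infinite) (z : Circle) (ϑ : ℝ)
    (hz : z ≠ Circle.exp ϑ) (n : ℕ) {ζ a : ℂ} (hζ : ζ = z * conj (Circle.exp ϑ : ℂ))
    (ha : a = tau (verblunsky μ) ϑ n * verblunsky μ n) :
    (1 - conj a * a) * (kern μ (Circle.exp ϑ) (n + 1)).eval (z : ℂ) =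
      ((1 - a) * ζ + (1 - conj a)) * (kern μ (Circle.exp ϑ) n).eval (z : ℂ) -
        (1 - a) * (1 - conj a) * ζ * ((kern μ (Circle.exp ϑ) n).eval (z : ℂ) -
          conj ((monicOPUC μ n).eval (Circle.exp ϑ : ℂ)) / normSqOPUC μ n *
            (monicOPUC μ n).eval (z : ℂ)) := by
  have hS := tau_mul_star hμ ϑ n
  set w := Circle.exp ϑ with hw
  have hwc := circle_mul_conj w
  have hα := norm_verblunsky_lt_one hμ
  have hζ1 : 1 - ζ ≠ 0 := by
    intro h
    refine hz (Circle.ext ?_)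
    rw [hζ] at h
    linear_combination (-(w : ℂ)) * h - (z : ℂ) * hwc
  have hnz : (normSqOPUC μ n : ℂ) ≠ 0 := by exact_mod_cast (normSqOPUC_pos hμ n).ne'
  have hK := one_sub_mul_kern hμ z w n
  have hK' := one_sub_mul_kern hμ z w (n + 1)
  rw [star_monicOPUC_succ hμ n z, star_monicOPUC_succ hμ n w, eval_monicOPUC_succ hμ n z,
    eval_monicOPUC_succ hμ n w, ← hζ] at hK'
  rw [← hζ] at hK
  have hττ : tau (verblunsky μ) ϑ n * conj (tau (verblunsky μ) ϑ n) = 1 := by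
    rw [Complex.mul_conj', norm_tau hα]; norm_num
  have hN : (normSqOPUC μ (n + 1) : ℂ) = (1 - conj a * a) * normSqOPUC μ n := by
    rw [normSqOPUC_succ hμ, Complex.conj_mul', ha, norm_mul, norm_tau hα, one_mul]
    push_cast
    ring
  rw [hN] at hK'
  set A := (monicOPUC μ n).eval (z : ℂ)
  set B := (z : ℂ) ^ n * conj A
  set A' := (monicOPUC μ n).eval (w : ℂ)
  set b := (w : ℂ) ^ n * conj A'
  set α := verblunsky μ n
  set τ := tau (verblunsky μ) ϑ n
  set N := (normSqOPUC μ n : ℂ)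
  have hac : conj a = conj τ * conj α := by rw [ha, map_mul]
  have hA' : conj A' = w * conj τ * conj b := by
    have := congrArg conj hS.2
    rw [map_mul, map_mul] at this
    linear_combination (w : ℂ) * this - conj A' * hwc
  have hζw : ζ * w = z := by
    rw [hζ]; linear_combination (z : ℂ) * hwc
  simp only [map_sub, map_mul, Complex.conj_conj] at hK'
  -- Multiplied by `(1 - ζ) ‖Φ_n‖²`, each kernel becomes its Christoffel–Darboux numerator. With
  -- `Φ_n(w)` expressed through `Φ_n^*(w)` and `τ_n`, a polynomial identity remains.
  refine mul_left_cancel₀ (mul_ne_zero hζ1 hnz) ?_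
  have e1 : (1 - ζ) * N * (conj A' / N * A) = (1 - ζ) * (conj A' * A) := by
    field_simp
  have e2 : (1 - ζ) * ((1 - conj a * a) * N) * (kern μ w (n + 1)).eval (z : ℂ) =
      conj b * ((B - α * (z * A)) * (1 - conj a) - ζ * (z * A - conj α * B) * (conj τ - α)) := by
    rw [hK', hA', hac]
    linear_combination (conj τ * conj b *
      (-(conj α) * (B - α * (z * A)) - ζ * (z * A - conj α * B))) * hwc
  have e3 : (1 - ζ) * N * (kern μ w n).eval (z : ℂ) = conj b * (B - z * A * conj τ) := by
    rw [hK, hA']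
    linear_combination (-(A * conj τ * conj b)) * hζw
  have e4 : (1 - ζ) * N * ((kern μ w n).eval (z : ℂ) - conj A' / N * A) =
      conj b * (B - A * w * conj τ) := by
    rw [mul_sub, e1, e3, hA']
    linear_combination (A * conj τ * conj b) * hζw
  clear_value A B A' b α τ N
  clear hK hK' hS hN
  subst ha
  rw [hac] at *
  linear_combination e2 - ((1 - τ * α) * ζ + (1 - conj τ * conj α)) * e3 +
    (1 - τ * α) * (1 - conj τ * conj α) * ζ * e4 -
    (1 - τ * α) * (1 - conj τ * conj α) * conj b * A * conj τ * hζw +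
    conj b * (B * ζ * conj α * α - z * A * (ζ * α - α * (1 - conj τ * conj α))) * hττ

end Recurrence

/-! ### The weight of an arc -/

/-- Half the length of the complementary arc. -/
noncomputable def arcAngle (ϑ₁ ϑ₂ : ℝ) : ℝ := (2 * Real.pi + ϑ₁ - ϑ₂) / 2

/-- A trigonometric polynomial of degree one which is negative exactly on the arc. -/
noncomputable def arcWeight (ϑ₁ ϑ₂ : ℝ) : C(Circle, ℝ) where
  toFun z := (-conj (Circle.exp (arcAngle ϑ₁ ϑ₂) : ℂ) * (z - (Circle.exp ϑ₁ : ℂ)) *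
    conj (z - (Circle.exp ϑ₂ : ℂ))).re
  continuous_toFun := by
    have h : Continuous fun z : Circle => (z : ℂ) := continuous_induced_dom
    exact Complex.continuous_re.comp ((continuous_const.mul (h.sub continuous_const)).mul
      (Complex.continuous_conj.comp (h.sub continuous_const)))

lemma circle_exp_sub_conj (x : ℝ) :
    (Circle.exp x : ℂ) - conj (Circle.exp x : ℂ) = 2 * Complex.I * (Real.sin x : ℂ) := by
  rw [Complex.sub_conj, Circle.coe_exp, Complex.exp_ofReal_mul_I_im]
  push_cast
  ring

lemma circle_exp_sub_coe (x y : ℝ) :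
    (Circle.exp (x - y) : ℂ) = Circle.exp x * conj (Circle.exp y : ℂ) := by
  rw [Circle.exp_sub, Circle.coe_div, div_eq_mul_inv, ← Circle.coe_inv, Circle.coe_inv_eq_conj]

lemma circle_exp_add_self_coe (x : ℝ) :
    (Circle.exp x : ℂ) = (Circle.exp (x / 2) : ℂ) ^ 2 := by
  rw [sq, ← Circle.coe_mul, ← Circle.exp_add, add_halves]

lemma circle_exp_arcAngle (ϑ₁ ϑ₂ : ℝ) : (Circle.exp (arcAngle ϑ₁ ϑ₂) : ℂ) =
    -((Circle.exp (ϑ₁ / 2) : ℂ) * conj (Circle.exp (ϑ₂ / 2) : ℂ)) := by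
  rw [← circle_exp_sub_coe, arcAngle,
    show (2 * Real.pi + ϑ₁ - ϑ₂) / 2 = (ϑ₁ / 2 - ϑ₂ / 2) + Real.pi by ring, Circle.exp_add,
    Circle.coe_mul, Circle.coe_exp Real.pi, Complex.exp_pi_mul_I, mul_neg_one]

/-- Half-angle factorisation `e^{iθ} - e^{iϑ} = 2i e^{i(θ+ϑ)/2} sin((θ-ϑ)/2)`: the phases of the two
factors leave `e^{i(ϑ₁-ϑ₂)/2}`, which the prefactor cancels. -/
lemma arcFactor_exp (ϑ₁ ϑ₂ θ : ℝ) :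
    -conj (Circle.exp (arcAngle ϑ₁ ϑ₂) : ℂ) * ((Circle.exp θ : ℂ) - (Circle.exp ϑ₁ : ℂ)) *
        conj ((Circle.exp θ : ℂ) - (Circle.exp ϑ₂ : ℂ)) =
      ((4 * (Real.sin ((θ - ϑ₁) / 2) * Real.sin ((θ - ϑ₂) / 2)) : ℝ) : ℂ) := by
  have h1 := circle_exp_sub_conj ((θ - ϑ₁) / 2)
  have h2 := circle_exp_sub_conj ((θ - ϑ₂) / 2)
  rw [show (θ - ϑ₁) / 2 = θ / 2 - ϑ₁ / 2 by ring, circle_exp_sub_coe] at *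
  rw [show (θ - ϑ₂) / 2 = θ / 2 - ϑ₂ / 2 by ring, circle_exp_sub_coe] at *
  rw [circle_exp_arcAngle, circle_exp_add_self_coe θ, circle_exp_add_self_coe ϑ₁,
    circle_exp_add_self_coe ϑ₂]
  have hu := circle_mul_conj (Circle.exp (θ / 2))
  have hp := circle_mul_conj (Circle.exp (ϑ₁ / 2))
  have hq := circle_mul_conj (Circle.exp (ϑ₂ / 2))
  have hI := Complex.I_sq
  simp only [map_sub, map_mul, map_neg, map_pow, Complex.conj_conj] at *
  set u : ℂ := (Circle.exp (θ / 2) : ℂ)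
  set p : ℂ := (Circle.exp (ϑ₁ / 2) : ℂ)
  set q : ℂ := (Circle.exp (ϑ₂ / 2) : ℂ)
  have h3 := congrArg₂ (· * ·) h1 h2
  push_cast at h3 ⊢
  linear_combination (q * conj p * u * conj u - p * conj q) * hu -
    conj p * conj q * u ^ 2 * hq - p * q * conj u ^ 2 * hp +
    p * conj q * (q * conj q * hp + hq) - h3 -
    4 * (Complex.sin (θ / 2 - ϑ₁ / 2) * Complex.sin (θ / 2 - ϑ₂ / 2)) * hI

lemma exists_circle_exp_eq (z : Circle) (a : ℝ) :
    ∃ θ, a ≤ θ ∧ θ < a + 2 * Real.pi ∧ Circle.exp θ = z := by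
  have h := toIcoMod_mem_Ico Real.two_pi_pos a (Complex.arg z)
  refine ⟨_, h.1, h.2, ?_⟩
  rw [toIcoMod, Circle.periodic_exp.sub_zsmul_eq, Circle.exp_arg]

lemma coe_arcWeight (ϑ₁ ϑ₂ : ℝ) (z : Circle) : (arcWeight ϑ₁ ϑ₂ z : ℂ) =
    -conj (Circle.exp (arcAngle ϑ₁ ϑ₂) : ℂ) * (z - (Circle.exp ϑ₁ : ℂ)) *
      conj (z - (Circle.exp ϑ₂ : ℂ)) := by
  obtain ⟨θ, -, -, rfl⟩ := exists_circle_exp_eq z 0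
  change (((-conj (Circle.exp (arcAngle ϑ₁ ϑ₂) : ℂ) * ((Circle.exp θ : ℂ) - (Circle.exp ϑ₁ : ℂ)) *
    conj ((Circle.exp θ : ℂ) - (Circle.exp ϑ₂ : ℂ))).re : ℝ) : ℂ) = _
  rw [arcFactor_exp, Complex.ofReal_re]

lemma arcWeight_exp (ϑ₁ ϑ₂ θ : ℝ) : arcWeight ϑ₁ ϑ₂ (Circle.exp θ) =
    4 * (Real.sin ((θ - ϑ₁) / 2) * Real.sin ((θ - ϑ₂) / 2)) := by
  have h := coe_arcWeight ϑ₁ ϑ₂ (Circle.exp θ)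
  rw [arcFactor_exp] at h
  exact_mod_cast h

lemma arcWeight_neg_of_mem {ϑ₁ ϑ₂ : ℝ} (hle : ϑ₂ - ϑ₁ ≤ 2 * Real.pi) {z : Circle}
    (hz : z ∈ openArc ϑ₁ ϑ₂) : arcWeight ϑ₁ ϑ₂ z < 0 := by
  obtain ⟨θ, ⟨h1, h2⟩, rfl⟩ := hz
  rw [arcWeight_exp]
  have s1 : 0 < Real.sin ((θ - ϑ₁) / 2) :=
    Real.sin_pos_of_pos_of_lt_pi (by linarith) (by linarith)
  have s2 : Real.sin ((θ - ϑ₂) / 2) < 0 :=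
    Real.sin_neg_of_neg_of_neg_pi_lt (by linarith) (by linarith)
  linarith [mul_neg_of_pos_of_neg s1 s2]

lemma arcWeight_nonneg_of_notMem {ϑ₁ ϑ₂ : ℝ} (hpos : 0 < ϑ₂ - ϑ₁) {z : Circle}
    (hz : z ∉ openArc ϑ₁ ϑ₂) : 0 ≤ arcWeight ϑ₁ ϑ₂ z := by
  obtain ⟨θ, h1, h2, rfl⟩ := exists_circle_exp_eq z ϑ₁
  rw [arcWeight_exp]
  rcases h1.eq_or_lt with rfl | h1
  · simp
  have h3 : ϑ₂ ≤ θ := not_lt.1 fun h => hz ⟨θ, ⟨h1, h⟩, rfl⟩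
  have s1 : 0 ≤ Real.sin ((θ - ϑ₁) / 2) :=
    Real.sin_nonneg_of_nonneg_of_le_pi (by linarith) (by linarith)
  have s2 : 0 ≤ Real.sin ((θ - ϑ₂) / 2) :=
    Real.sin_nonneg_of_nonneg_of_le_pi (by linarith) (by linarith)
  positivity

lemma finite_arcWeight_eq_zero (ϑ₁ ϑ₂ : ℝ) : {z | arcWeight ϑ₁ ϑ₂ z = 0}.Finite := by
  refine (Set.toFinite {Circle.exp ϑ₁, Circle.exp ϑ₂}).subset fun z hz => ?_
  have h := coe_arcWeight ϑ₁ ϑ₂ z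
  rw [show arcWeight ϑ₁ ϑ₂ z = 0 from hz, Complex.ofReal_zero] at h
  rcases mul_eq_zero.1 h.symm with h | h
  · rcases mul_eq_zero.1 h with h | h
    · simp at h
    · exact Or.inl (Circle.ext (sub_eq_zero.1 h))
  · rw [map_eq_zero] at h
    exact Or.inr (Circle.ext (sub_eq_zero.1 h))

lemma twistedForm_eq_integral (μ : Measure Circle) (ϑ₁ ϑ₂ : ℝ) (p q : ℂ[X]) :
    -conj (Circle.exp (arcAngle ϑ₁ ϑ₂) : ℂ) *
        twistedForm μ (Circle.exp ϑ₁) (Circle.exp ϑ₂) p q =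
      ∫ z : Circle, (arcWeight ϑ₁ ϑ₂ z : ℂ) * (p.eval (z : ℂ) * conj (q.eval (z : ℂ))) ∂μ := by
  rw [twistedForm, ip, ← integral_const_mul]
  congr 1 with z
  rw [coe_arcWeight]
  simp only [eval_mul, eval_sub, eval_X, eval_C, map_mul]
  ring

lemma twistedForm_self (μ : Measure Circle) (ϑ₁ ϑ₂ : ℝ) (p : ℂ[X]) :
    -conj (Circle.exp (arcAngle ϑ₁ ϑ₂) : ℂ) *
        twistedForm μ (Circle.exp ϑ₁) (Circle.exp ϑ₂) p p =
      ((∫ z : Circle, ‖p.eval (z : ℂ)‖ ^ 2 * arcWeight ϑ₁ ϑ₂ z ∂μ : ℝ) : ℂ) := by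
  rw [twistedForm_eq_integral, ← integral_complex_ofReal]
  congr 1 with z
  rw [Complex.mul_conj']
  push_cast
  ring

/-- The twisted form is Hermitian only after multiplication by a unimodular constant, which makes
its weight real; this suffices for symmetric orthogonality. -/
lemma twistedForm_eq_zero_comm (μ : Measure Circle) (ϑ₁ ϑ₂ : ℝ) {p q : ℂ[X]}
    (h : twistedForm μ (Circle.exp ϑ₁) (Circle.exp ϑ₂) p q = 0) :
    twistedForm μ (Circle.exp ϑ₁) (Circle.exp ϑ₂) q p = 0 := by
  have h1 := twistedForm_eq_integral μ ϑ₁ ϑ₂ p q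
  rw [h, mul_zero] at h1
  have h2 := congrArg conj h1
  rw [← integral_conj, map_zero] at h2
  have h3 := twistedForm_eq_integral μ ϑ₁ ϑ₂ q p
  have h4 : (∫ z : Circle, (arcWeight ϑ₁ ϑ₂ z : ℂ) *
      (q.eval (z : ℂ) * conj (p.eval (z : ℂ))) ∂μ) = 0 := by
    rw [h2]
    congr 1 with z
    simp only [map_mul, Complex.conj_ofReal, Complex.conj_conj]
    ring
  rw [h4] at h3
  refine (mul_eq_zero.1 h3).resolve_left ?_
  simp

/-! ### The real form of the recurrence -/

section RealRecurrence

/-- The common factor is `h = 2 (1 - Re a)`. Dividing the kernel recurrence by it produces exactly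
the coefficients `c_n` and `g_n`. -/
lemma recurrence_coeffs {a : ℂ} (ha : ‖a‖ < 1) (φ : ℝ) {c g : ℝ}
    (hc : c = -a.im / (1 - a.re)) (hg : g = 1 / 2 * (‖1 - a‖ ^ 2 / (1 - a.re))) :
    (0 < g ∧ g < 1) ∧ ∃ h : ℝ, h ≠ 0 ∧ 1 - conj a * a = (h : ℂ) * (1 - g) ∧
      (1 - a) * (1 - conj a) = (h : ℂ) * g ∧
      (1 - a) * (Circle.exp φ : ℂ) + (1 - conj a) * conj (Circle.exp φ : ℂ) =
        (h : ℂ) * ((Real.cos φ - c * Real.sin φ : ℝ) : ℂ) := by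
  have hre : 0 < 1 - a.re := by linarith [(Complex.re_le_norm a)]
  have hn : ‖1 - a‖ ^ 2 = 1 - 2 * a.re + ‖a‖ ^ 2 := by
    rw [← Complex.normSq_eq_norm_sq, ← Complex.normSq_eq_norm_sq, Complex.normSq_apply,
      Complex.normSq_apply]
    simp
    ring
  have hpos : 0 < ‖1 - a‖ ^ 2 := by
    have := norm_pos_iff.2 (one_sub_ne_zero_of_norm_lt_one ha)
    positivity
  have hg' : 2 * (1 - a.re) * g = ‖1 - a‖ ^ 2 := by
    rw [hg]; field_simp
  have hc' : (1 - a.re) * c = -a.im := by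
    rw [hc]; field_simp
  have hsq : ‖a‖ ^ 2 < 1 := by nlinarith [norm_nonneg a]
  refine ⟨⟨by rw [hg]; positivity, by nlinarith⟩, 2 * (1 - a.re), by positivity, ?_, ?_, ?_⟩
  · have : (1 : ℝ) - ‖a‖ ^ 2 = 2 * (1 - a.re) * (1 - g) := by linarith
    rw [Complex.conj_mul']
    exact_mod_cast this
  · have e : (1 - a) * (1 - conj a) = ((‖1 - a‖ ^ 2 : ℝ) : ℂ) := by
      rw [← Complex.normSq_eq_norm_sq, ← Complex.mul_conj, map_sub, map_one]
    rw [e, ← hg']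
    push_cast
    ring
  · have e : (1 - a) * (Circle.exp φ : ℂ) + (1 - conj a) * conj (Circle.exp φ : ℂ) =
        ((2 * ((1 - a) * (Circle.exp φ : ℂ)).re : ℝ) : ℂ) := by
      rw [← Complex.add_conj, map_mul, map_sub, map_one]
    rw [e, ← Complex.ofReal_mul]
    congr 1
    rw [Complex.mul_re, Circle.coe_exp, Complex.exp_ofReal_mul_I_re, Complex.exp_ofReal_mul_I_im]
    simp only [Complex.sub_re, Complex.one_re, Complex.sub_im, Complex.one_im]
    linear_combination (2 * Real.sin φ) * hc'

lemma gCoeff_mem {α : ℕ → ℂ} (hα : ∀ n, ‖α n‖ < 1) (ϑ : ℝ) (n : ℕ) :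
    0 < gCoeff α ϑ (n + 1) ∧ gCoeff α ϑ (n + 1) < 1 :=
  (recurrence_coeffs (norm_tau_mul_lt_one hα ϑ n) 0 rfl rfl).1

variable {μ : Measure Circle} [IsFiniteMeasure μ]

lemma circle_exp_arcAngle_sq (ϑ₁ ϑ₂ : ℝ) : (Circle.exp (arcAngle ϑ₁ ϑ₂) : ℂ) ^ 2 =
    Circle.exp ϑ₁ * conj (Circle.exp ϑ₂ : ℂ) := by
  rw [circle_exp_arcAngle, circle_exp_add_self_coe ϑ₁, circle_exp_add_self_coe ϑ₂, map_pow]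
  ring

lemma circle_exp_ne {ϑ₁ ϑ₂ : ℝ} (hpos : 0 < ϑ₂ - ϑ₁) (hlt : ϑ₂ - ϑ₁ < 2 * Real.pi) :
    Circle.exp ϑ₁ ≠ Circle.exp ϑ₂ := by
  intro h
  have h1 := circle_exp_arcAngle_sq ϑ₁ ϑ₂
  rw [h, circle_mul_conj] at h1
  have h2 : 0 < Real.sin (arcAngle ϑ₁ ϑ₂) := by
    rw [arcAngle]
    exact Real.sin_pos_of_pos_of_lt_pi (by linarith) (by linarith)
  have h3 := congrArg Complex.re h1
  rw [sq, Complex.mul_re, Circle.coe_exp, Complex.exp_ofReal_mul_I_re,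
    Complex.exp_ofReal_mul_I_im, Complex.one_re] at h3
  nlinarith [Real.sin_sq_add_cos_sq (arcAngle ϑ₁ ϑ₂)]

variable (μ) in
/-- The kernel at the endpoints of the arc, rotated to be real. -/
noncomputable def rotatedKern (ϑ₁ ϑ₂ : ℝ) (n : ℕ) : ℂ :=
  conj (Circle.exp (arcAngle ϑ₁ ϑ₂) : ℂ) ^ n *
    (kern μ (Circle.exp ϑ₂) n).eval (Circle.exp ϑ₁ : ℂ)

omit [IsFiniteMeasure μ] in
lemma rotatedKern_zero (ϑ₁ ϑ₂ : ℝ) :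
    rotatedKern μ ϑ₁ ϑ₂ 0 = ((1 / normSqOPUC μ 0 : ℝ) : ℂ) := by
  rw [rotatedKern, kern_zero]
  simp

variable (μ) in
/-- The linear factor `x - c_{n+1} √(1 - x²)` at `x = cos φ`. -/
noncomputable def linFactor (ϑ₁ ϑ₂ : ℝ) (n : ℕ) : ℝ :=
  Real.cos (arcAngle ϑ₁ ϑ₂) -
    cCoeff (verblunsky μ) ϑ₂ (n + 1) * Real.sin (arcAngle ϑ₁ ϑ₂)

/-- Since `z₁ conj w = e²`, multiplying the kernel recurrence by `conj e ^ (n + 1)` symmetrises the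
middle coefficient into a real one. Keeping `K_{n-1}` as a difference includes `n = 0`, where it is
zero. -/
lemma rotatedKern_recurrence_aux (hμ : μ.support.Infinite) {ϑ₁ ϑ₂ : ℝ} (hpos : 0 < ϑ₂ - ϑ₁)
    (hlt : ϑ₂ - ϑ₁ < 2 * Real.pi) (n : ℕ) :
    (1 - gCoeff (verblunsky μ) ϑ₂ (n + 1) : ℂ) * rotatedKern μ ϑ₁ ϑ₂ (n + 1) =
      linFactor μ ϑ₁ ϑ₂ n * rotatedKern μ ϑ₁ ϑ₂ n -
        gCoeff (verblunsky μ) ϑ₂ (n + 1) *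
          (conj (Circle.exp (arcAngle ϑ₁ ϑ₂) : ℂ) ^ n * Circle.exp (arcAngle ϑ₁ ϑ₂) *
            ((kern μ (Circle.exp ϑ₂) n).eval (Circle.exp ϑ₁ : ℂ) -
              conj ((monicOPUC μ n).eval (Circle.exp ϑ₂ : ℂ)) / normSqOPUC μ n *
                (monicOPUC μ n).eval (Circle.exp ϑ₁ : ℂ))) := by
  have hα := norm_verblunsky_lt_one hμ
  obtain ⟨-, h, h0, h1, h2, h3⟩ := recurrence_coeffs (norm_tau_mul_lt_one hα ϑ₂ n)
    (arcAngle ϑ₁ ϑ₂) (c := cCoeff (verblunsky μ) ϑ₂ (n + 1))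
    (g := gCoeff (verblunsky μ) ϑ₂ (n + 1)) rfl rfl
  have hK := kern_recurrence_aux hμ (Circle.exp ϑ₁) ϑ₂ (circle_exp_ne hpos hlt) n
    (circle_exp_arcAngle_sq ϑ₁ ϑ₂) rfl
  have he := circle_mul_conj (Circle.exp (arcAngle ϑ₁ ϑ₂))
  rw [h1, h2] at hK
  rw [rotatedKern, rotatedKern, linFactor]
  set e : ℂ := (Circle.exp (arcAngle ϑ₁ ϑ₂) : ℂ)
  set a := tau (verblunsky μ) ϑ₂ n * verblunsky μ n
  set D := (kern μ (Circle.exp ϑ₂) n).eval (Circle.exp ϑ₁ : ℂ) -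
    conj ((monicOPUC μ n).eval (Circle.exp ϑ₂ : ℂ)) / normSqOPUC μ n *
      (monicOPUC μ n).eval (Circle.exp ϑ₁ : ℂ)
  set K := (kern μ (Circle.exp ϑ₂) n).eval (Circle.exp ϑ₁ : ℂ)
  refine mul_left_cancel₀ (Complex.ofReal_ne_zero.2 h0) ?_
  rw [pow_succ]
  linear_combination (conj e ^ n * conj e) * hK + (conj e ^ n * K) * h3 +
    (conj e ^ n * e * ((1 - a) * K - h * gCoeff (verblunsky μ) ϑ₂ (n + 1) * D)) * he

lemma rotatedKern_one (hμ : μ.support.Infinite) {ϑ₁ ϑ₂ : ℝ} (hpos : 0 < ϑ₂ - ϑ₁)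
    (hlt : ϑ₂ - ϑ₁ < 2 * Real.pi) :
    (1 - gCoeff (verblunsky μ) ϑ₂ 1 : ℂ) * rotatedKern μ ϑ₁ ϑ₂ 1 =
      linFactor μ ϑ₁ ϑ₂ 0 * rotatedKern μ ϑ₁ ϑ₂ 0 := by
  rw [rotatedKern_recurrence_aux hμ hpos hlt 0, kern_zero]
  simp

lemma rotatedKern_add_two (hμ : μ.support.Infinite) {ϑ₁ ϑ₂ : ℝ} (hpos : 0 < ϑ₂ - ϑ₁)
    (hlt : ϑ₂ - ϑ₁ < 2 * Real.pi) (n : ℕ) :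
    (1 - gCoeff (verblunsky μ) ϑ₂ (n + 2) : ℂ) * rotatedKern μ ϑ₁ ϑ₂ (n + 2) =
      linFactor μ ϑ₁ ϑ₂ (n + 1) * rotatedKern μ ϑ₁ ϑ₂ (n + 1) -
        gCoeff (verblunsky μ) ϑ₂ (n + 2) * rotatedKern μ ϑ₁ ϑ₂ n := by
  rw [rotatedKern_recurrence_aux hμ hpos hlt (n + 1)]
  have he := circle_mul_conj (Circle.exp (arcAngle ϑ₁ ϑ₂))
  have hK : (kern μ (Circle.exp ϑ₂) (n + 1)).eval (Circle.exp ϑ₁ : ℂ) -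
      conj ((monicOPUC μ (n + 1)).eval (Circle.exp ϑ₂ : ℂ)) / normSqOPUC μ (n + 1) *
        (monicOPUC μ (n + 1)).eval (Circle.exp ϑ₁ : ℂ) =
      (kern μ (Circle.exp ϑ₂) n).eval (Circle.exp ϑ₁ : ℂ) := by
    rw [kern_succ, eval_add, eval_mul, eval_C]
    ring
  rw [hK, rotatedKern.eq_def μ ϑ₁ ϑ₂ n, pow_succ]
  linear_combination (-(gCoeff (verblunsky μ) ϑ₂ (n + 2) : ℂ) *
    conj (Circle.exp (arcAngle ϑ₁ ϑ₂) : ℂ) ^ n *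
    (kern μ (Circle.exp ϑ₂) n).eval (Circle.exp ϑ₁ : ℂ)) * he

/-- The recurrence has real coefficients and a real initial value, and `1 - g_n ≠ 0`. -/
lemma rotatedKern_im (hμ : μ.support.Infinite) {ϑ₁ ϑ₂ : ℝ} (hpos : 0 < ϑ₂ - ϑ₁)
    (hlt : ϑ₂ - ϑ₁ < 2 * Real.pi) (n : ℕ) : (rotatedKern μ ϑ₁ ϑ₂ n).im = 0 := by
  have hG := gCoeff_mem (norm_verblunsky_lt_one hμ) ϑ₂
  induction n using Nat.strong_induction_on with
  | _ n ih =>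
    match n with
    | 0 => rw [rotatedKern_zero, Complex.ofReal_im]
    | 1 =>
      have h := congrArg Complex.im (rotatedKern_one hμ hpos hlt)
      rw [← Complex.ofReal_one, ← Complex.ofReal_sub, Complex.im_ofReal_mul,
        Complex.im_ofReal_mul, ih 0 one_pos, mul_zero] at h
      exact (mul_eq_zero.1 h).resolve_left (by linarith [hG 0])
    | n + 2 =>
      have h := congrArg Complex.im (rotatedKern_add_two hμ hpos hlt n)
      rw [← Complex.ofReal_one, ← Complex.ofReal_sub, Complex.sub_im, Complex.im_ofReal_mul,
        Complex.im_ofReal_mul, Complex.im_ofReal_mul, ih n (by omega), ih (n + 1) (by omega),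
        mul_zero, mul_zero, sub_zero] at h
      exact (mul_eq_zero.1 h).resolve_left (by linarith [hG (n + 1)])

lemma kern_eval_eq (hμ : μ.support.Infinite) {ϑ₁ ϑ₂ : ℝ} (hpos : 0 < ϑ₂ - ϑ₁)
    (hlt : ϑ₂ - ϑ₁ < 2 * Real.pi) (n : ℕ) :
    (kern μ (Circle.exp ϑ₂) n).eval (Circle.exp ϑ₁ : ℂ) =
      (Circle.exp (arcAngle ϑ₁ ϑ₂) : ℂ) ^ n * ((rotatedKern μ ϑ₁ ϑ₂ n).re : ℂ) := by
  have h : ((rotatedKern μ ϑ₁ ϑ₂ n).re : ℂ) = rotatedKern μ ϑ₁ ϑ₂ n :=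
    Complex.ext rfl (rotatedKern_im hμ hpos hlt n).symm
  rw [h, rotatedKern, ← mul_assoc, ← mul_pow, circle_mul_conj, one_pow, one_mul]

lemma rotatedKern_re_alternating_iff (hμ : μ.support.Infinite) {ϑ₁ ϑ₂ : ℝ} (hpos : 0 < ϑ₂ - ϑ₁)
    (hlt : ϑ₂ - ϑ₁ < 2 * Real.pi) :
    (∀ n, (rotatedKern μ ϑ₁ ϑ₂ n).re * (rotatedKern μ ϑ₁ ϑ₂ (n + 1)).re < 0) ↔
      linFactor μ ϑ₁ ϑ₂ 0 < 0 ∧ ∀ n, 1 ≤ n → 0 < mSeq (verblunsky μ) ϑ₁ ϑ₂ n ∧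
        mSeq (verblunsky μ) ϑ₁ ϑ₂ n < 1 := by
  have hsin : 0 ≤ Real.sin (arcAngle ϑ₁ ϑ₂) := by
    rw [arcAngle]
    exact Real.sin_nonneg_of_nonneg_of_le_pi (by linarith) (by linarith)
  refine alternating_iff_chain (V := fun n => (rotatedKern μ ϑ₁ ϑ₂ n).re)
    (gCoeff_mem (norm_verblunsky_lt_one hμ) ϑ₂) ?_ ?_ (fun n => ?_) rfl (fun n => ?_)
  · rw [rotatedKern_zero, Complex.ofReal_re]
    exact one_div_pos.2 (normSqOPUC_pos hμ 0)
  · have h := congrArg Complex.re (rotatedKern_one hμ hpos hlt)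
    rwa [← Complex.ofReal_one, ← Complex.ofReal_sub, Complex.re_ofReal_mul,
      Complex.re_ofReal_mul] at h
  · have h := congrArg Complex.re (rotatedKern_add_two hμ hpos hlt n)
    rwa [← Complex.ofReal_one, ← Complex.ofReal_sub, Complex.sub_re, Complex.re_ofReal_mul,
      Complex.re_ofReal_mul, Complex.re_ofReal_mul] at h
  -- The angle lies in `[0, π]`, so the root is the sine itself. With `G n = g_{n+1}` the chain
  -- numerator `(1 - G n) * G (n + 1)` is `d_{n+2}`, as `mSeq` at `n + 1` requires.
  · have hx : √(1 - xPoint ϑ₁ ϑ₂ ^ 2) = Real.sin (arcAngle ϑ₁ ϑ₂) := by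
      rw [xPoint, ← arcAngle, ← Real.sin_sq, Real.sqrt_sq hsin]
    rw [mSeq, dFrakSucc, hx]
    rfl

end RealRecurrence

/-! ### The gap criterion -/

section Gap

variable {μ : Measure Circle} [IsFiniteMeasure μ]

lemma twistedForm_add_mul (z₁ w : Circle) {p q : ℂ[X]} (c : ℂ)
    (h1 : twistedForm μ z₁ w p q = 0) (h2 : twistedForm μ z₁ w q p = 0) :
    twistedForm μ z₁ w (C c * p + q) (C c * p + q) =
      c * conj c * twistedForm μ z₁ w p p + twistedForm μ z₁ w q q := by
  simp only [twistedForm] at *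
  rw [show ∀ f : ℂ[X], f * (C c * p + q) = C c * (f * p) + f * q from fun f => by ring,
    show ∀ f : ℂ[X], f * (C c * p + q) = C c * (f * p) + f * q from fun f => by ring,
    ip_add_left, ip_add_right, ip_add_right, ip_C_mul_left, ip_C_mul_left, ip_C_mul_right,
    ip_C_mul_right, h1, h2]
  ring

/-- The values of the weighted form at its orthogonal polynomials. -/
lemma exists_twisted_orthogonal_real (hμ : μ.support.Infinite) {ϑ₁ ϑ₂ : ℝ}
    (hpos : 0 < ϑ₂ - ϑ₁) (hlt : ϑ₂ - ϑ₁ < 2 * Real.pi) (n : ℕ) :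
    ∃ p : ℂ[X], p.degree < (n + 1 : ℕ) ∧
      p.coeff n = (kern μ (Circle.exp ϑ₂) n).eval (Circle.exp ϑ₁ : ℂ) ∧
      (∀ q : ℂ[X], q.degree < n → twistedForm μ (Circle.exp ϑ₁) (Circle.exp ϑ₂) p q = 0) ∧
      ∫ z : Circle, ‖p.eval (z : ℂ)‖ ^ 2 * arcWeight ϑ₁ ϑ₂ z ∂μ =
        -((rotatedKern μ ϑ₁ ϑ₂ n).re * (rotatedKern μ ϑ₁ ϑ₂ (n + 1)).re) *
          normSqOPUC μ (n + 1) := by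
  obtain ⟨p, h1, h2, h3, h4⟩ :=
    exists_twisted_orthogonal hμ (Circle.exp ϑ₁) (Circle.exp ϑ₂) n
  refine ⟨p, h1, h2, h3, ?_⟩
  have h := twistedForm_self μ ϑ₁ ϑ₂ p
  rw [h4, kern_eval_eq hμ hpos hlt, kern_eval_eq hμ hpos hlt, map_mul, map_pow,
    Complex.conj_ofReal, pow_succ] at h
  have he : (Circle.exp (arcAngle ϑ₁ ϑ₂) : ℂ) ^ n *
      conj (Circle.exp (arcAngle ϑ₁ ϑ₂) : ℂ) ^ n = 1 := by
    rw [← mul_pow, circle_mul_conj, one_pow]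
  have he1 := circle_mul_conj (Circle.exp (arcAngle ϑ₁ ϑ₂))
  apply Complex.ofReal_injective
  rw [← h]
  simp only [Complex.ofReal_mul, Complex.ofReal_neg]
  set e : ℂ := (Circle.exp (arcAngle ϑ₁ ϑ₂) : ℂ)
  set V : ℂ := ((rotatedKern μ ϑ₁ ϑ₂ n).re : ℂ)
  set V' : ℂ := ((rotatedKern μ ϑ₁ ϑ₂ (n + 1)).re : ℂ)
  linear_combination (-(V * V' * normSqOPUC μ (n + 1))) * he1 -
    (e * conj e * V * V' * normSqOPUC μ (n + 1)) * he

lemma gap_iff_alternating (hμ : μ.support.Infinite) {ϑ₁ ϑ₂ : ℝ}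
    (hpos : 0 < ϑ₂ - ϑ₁) (hlt : ϑ₂ - ϑ₁ < 2 * Real.pi) :
    μ.support ∩ openArc ϑ₁ ϑ₂ = ∅ ↔
      ∀ n, (rotatedKern μ ϑ₁ ϑ₂ n).re * (rotatedKern μ ϑ₁ ϑ₂ (n + 1)).re < 0 := by
  constructor
  · intro h
    have hs : ∀ z ∈ μ.support, 0 ≤ arcWeight ϑ₁ ϑ₂ z := fun z hz =>
      arcWeight_nonneg_of_notMem hpos fun hz' => by
        have : z ∈ μ.support ∩ openArc ϑ₁ ϑ₂ := ⟨hz, hz'⟩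
        rw [h] at this
        exact this
    have hform : ∀ p : ℂ[X], p ≠ 0 → _ := fun p hp =>
      form_pos_of_nonneg_on_support hμ hs (finite_arcWeight_eq_zero ϑ₁ ϑ₂) hp
    -- The `n`-th orthogonal polynomial has top coefficient `e^n V_n`, so it is known to be nonzero
    -- only once `V_n ≠ 0`; induction supplies this.
    have step : ∀ n, (rotatedKern μ ϑ₁ ϑ₂ n).re ≠ 0 →
        (rotatedKern μ ϑ₁ ϑ₂ n).re * (rotatedKern μ ϑ₁ ϑ₂ (n + 1)).re < 0 := by
      intro n hn
      obtain ⟨p, -, hc, -, hint⟩ := exists_twisted_orthogonal_real hμ hpos hlt n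
      have hp : p ≠ 0 := by
        rintro rfl
        rw [coeff_zero, kern_eval_eq hμ hpos hlt] at hc
        refine mul_ne_zero (pow_ne_zero n ?_) (Complex.ofReal_ne_zero.2 hn) hc.symm
        exact Circle.coe_ne_zero _
      have h1 := hform p hp
      rw [hint] at h1
      have h2 := pos_of_mul_pos_left h1 (normSqOPUC_pos hμ (n + 1)).le
      linarith
    have hne : ∀ n, (rotatedKern μ ϑ₁ ϑ₂ n).re ≠ 0 := by
      intro n
      induction n with
      | zero =>
        rw [rotatedKern_zero, Complex.ofReal_re]
        exact (one_div_pos.2 (normSqOPUC_pos hμ 0)).ne'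
      | succ n ih => exact right_ne_zero_of_mul (step n ih).ne
    exact fun n => step n (hne n)
  · intro h
    have hnn : ∀ (n : ℕ) (p : ℂ[X]), p.degree < n →
        0 ≤ ∫ z : Circle, ‖p.eval (z : ℂ)‖ ^ 2 * arcWeight ϑ₁ ϑ₂ z ∂μ := by
      intro n
      induction n with
      | zero =>
        intro p hp
        have : p = 0 := by simpa using hp
        simp [this]
      | succ n ih =>
        intro p hp
        obtain ⟨f, hf, hc, horth, hint⟩ := exists_twisted_orthogonal_real hμ hpos hlt n
        -- Alternation gives `V_n ≠ 0`, so `f` has exact degree `n` and the top term of `p` can be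
        -- removed. The form splits orthogonally over `f` and the remainder.
        have hf0 : f.coeff n ≠ 0 := by
          rw [hc, kern_eval_eq hμ hpos hlt]
          exact mul_ne_zero (pow_ne_zero n (Circle.coe_ne_zero _))
            (Complex.ofReal_ne_zero.2 (left_ne_zero_of_mul (h n).ne))
        set c := p.coeff n / f.coeff n
        have hq := degree_sub_C_mul_lt hp hf (c := c) (div_mul_cancel₀ _ hf0).symm
        set q := p - C c * f with hqdef
        have hp' : p = C c * f + q := by rw [hqdef]; ring
        have h1 := horth q hq
        have h2 := twistedForm_add_mul (Circle.exp ϑ₁) (Circle.exp ϑ₂) c h1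
          (twistedForm_eq_zero_comm μ ϑ₁ ϑ₂ h1)
        rw [← hp'] at h2
        have h3 : (∫ z : Circle, ‖p.eval (z : ℂ)‖ ^ 2 * arcWeight ϑ₁ ϑ₂ z ∂μ) =
            ‖c‖ ^ 2 * (∫ z : Circle, ‖f.eval (z : ℂ)‖ ^ 2 * arcWeight ϑ₁ ϑ₂ z ∂μ) +
              ∫ z : Circle, ‖q.eval (z : ℂ)‖ ^ 2 * arcWeight ϑ₁ ϑ₂ z ∂μ := by
          apply Complex.ofReal_injective
          rw [Complex.ofReal_add, Complex.ofReal_mul, ← twistedForm_self, ← twistedForm_self,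
            ← twistedForm_self, h2, Complex.mul_conj']
          push_cast
          ring
        rw [h3, hint]
        have h4 := h n
        have h5 := normSqOPUC_pos hμ (n + 1)
        exact add_nonneg (mul_nonneg (by positivity) (mul_nonneg (by linarith) h5.le)) (ih q hq)
    refine Set.eq_empty_of_forall_notMem fun z hz => ?_
    have h1 := nonneg_on_support_of_form_nonneg (s := arcWeight ϑ₁ ϑ₂)
      (fun p => hnn (p.natDegree + 1) p (degree_le_natDegree.trans_lt
        (by exact_mod_cast p.natDegree.lt_succ_self))) hz.1
    exact absurd (arcWeight_neg_of_mem hlt.le hz.2) (not_lt.2 h1)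

omit [IsFiniteMeasure μ] in
lemma cotTop_lt_iff {ϑ₁ ϑ₂ : ℝ} (hpos : 0 < ϑ₂ - ϑ₁) (hlt : ϑ₂ - ϑ₁ < 2 * Real.pi) :
    cotTop ((2 * Real.pi + ϑ₁ - ϑ₂) / 2) < (cCoeff (verblunsky μ) ϑ₂ 1 : EReal) ↔
      linFactor μ ϑ₁ ϑ₂ 0 < 0 := by
  have hsin : 0 < Real.sin (arcAngle ϑ₁ ϑ₂) := by
    rw [arcAngle]
    exact Real.sin_pos_of_pos_of_lt_pi (by linarith) (by linarith)
  rw [cotTop, if_neg (by linarith), EReal.coe_lt_coe_iff, Real.cot_eq_cos_div_sin, ← arcAngle,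
    div_lt_iff₀ hsin, linFactor, sub_neg]

omit [IsFiniteMeasure μ] in
/-- The whole circle without a point meets every infinite set. -/
lemma support_inter_openArc_nonempty (hμ : μ.support.Infinite) {ϑ₁ ϑ₂ : ℝ}
    (h : ϑ₂ - ϑ₁ = 2 * Real.pi) : (μ.support ∩ openArc ϑ₁ ϑ₂).Nonempty := by
  obtain ⟨z, hz, hz'⟩ := (hμ.sdiff (Set.finite_singleton (Circle.exp ϑ₁))).nonempty
  obtain ⟨θ, h1, h2, rfl⟩ := exists_circle_exp_eq z ϑ₁
  refine ⟨_, hz, θ, ⟨lt_of_le_of_ne h1 ?_, by linarith⟩, rfl⟩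
  rintro rfl
  exact hz' rfl

end Gap

end RotatedOPUC

theorem mainTheorem2 (μ : MeasureTheory.Measure Circle) [MeasureTheory.IsFiniteMeasure μ]
    (hμ : μ.support.Infinite) (ϑ₁ ϑ₂ : ℝ)
    (hpos : 0 < ϑ₂ - ϑ₁) (hle : ϑ₂ - ϑ₁ ≤ 2 * Real.pi) (hϑ₂ : 0 < ϑ₂) :
    μ.support ∩ RotatedOPUC.openArc ϑ₁ ϑ₂ = ∅ ↔
      RotatedOPUC.cotTop ((2 * Real.pi + ϑ₁ - ϑ₂) / 2) <
          (RotatedOPUC.cCoeff (RotatedOPUC.verblunsky μ) ϑ₂ 1 : EReal) ∧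
        ∀ n : ℕ, 1 ≤ n →
          0 < RotatedOPUC.mSeq (RotatedOPUC.verblunsky μ) ϑ₁ ϑ₂ n ∧
            RotatedOPUC.mSeq (RotatedOPUC.verblunsky μ) ϑ₁ ϑ₂ n < 1 := by
  rcases hle.eq_or_lt with h | hlt
  -- For length `2π` the arc omits a single point, so it meets the infinite support, while the
  -- cotangent is `+∞`: both sides fail.
  · refine iff_of_false (RotatedOPUC.support_inter_openArc_nonempty hμ h).ne_empty ?_
    rintro ⟨hcot, -⟩
    rw [RotatedOPUC.cotTop, if_pos (by linarith)] at hcot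
    exact not_top_lt hcot
  · rw [RotatedOPUC.cotTop_lt_iff hpos hlt, RotatedOPUC.gap_iff_alternating hμ hpos hlt,
      RotatedOPUC.rotatedKern_re_alternating_iff hμ hpos hlt]
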